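/- Let $\alpha$ be an ordinal and let $d\ge 2$ be an integer. Let $X=\omega^{\alpha+1}\cdot d+1$ be the set of ordinals less than or equal to $\omega^{\alpha+1}\cdot d$ with the order topology, and let $H_{\alpha,d}=\mathrm{Homeo}(X)$ with the compact-open topology. Put $\mu_k=\omega^{\alpha+1}\cdot k$ for $1\le k\le d$ and $M_{\alpha,d}=\{\mu_1,\dots,\mu_d\}$ (the points of maximal Cantor–Bendixson rank). Let $N_{\alpha,d}$ be the set of points of next-to-maximal rank, that is, $N_{\alpha,d}=\{\omega^{\alpha+1}\cdot k+\omega^{\alpha}\cdot \ell : 0\le k<d,\ \ell\ge 1\}$, together with the point $0$ if $\alpha=0$. Let $PH_{\alpha,d}\le H_{\alpha,d}$ be the subgroup fixing every point of $M_{\alpha,d}$, let $F_{\alpha,d}\le H_{\alpha,d}$ be the subgroup of homeomorphisms that induce a permutation of $N_{\alpha,d}$ moving only finitely many points, and let $\overline F_{\alpha,d}$ be the closure of $F_{\alpha,d}$ in $H_{\alpha,d}$. Then the following hold. 1. $\overline F_{\alpha,d}\le PH_{\alpha,d}$, and there is a homomorphism $\chi=(\chi_1,\dots,\chi_{d-1}):PH_{\alpha,d}\to\mathbb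 Z^{d-1}$ such that $$1\to \overline F_{\alpha,d}\hookrightarrow PH_{\alpha,d}\xrightarrow{\ \chi\ }\mathbb Z^{d-1}\to 1$$ is a short exact sequence that is right split (some homomorphism $s:\mathbb Z^{d-1}\to PH_{\alpha,d}$ satisfies $\chi\circ s=\mathrm{id}$). Moreover, $\chi$ is the flux homomorphism: for every choice of pairwise disjoint clopen neighbourhoods $\Omega_1,\dots,\Omega_{d-1}$ of $\mu_1,\dots,\mu_{d-1}$ in $X$, none of which contains $\mu_d$, and for all $h\in PH_{\alpha,d}$ and $1\le k\le d-1$, the sets $O_k(h)=\{x\in N_{\alpha,d}\cap\Omega_k: h(x)\notin\Omega_k\}$ and $I_k(h)=\{x\in N_{\alpha,d}\smallsetminus\Omega_k: h(x)\in\Omega_k\}$ are finite and $\chi_k(h)=|O_k(h)|-|I_k(h)|$. 2. Every element of $H_{\alpha,d}$ maps $M_{\alpha,d}$ onto itself, and the resulting canonical action $\Phi:H_{\alpha,d}\to\mathrm{Sym}(M_{\alpha,d})$, $\Phi(h)=h|_{M_{\alpha,d}}$, gives a short exact sequence $$1\to PH_{\alpha,d}\hookrightarrow H_{\alpha,d}\xrightarrow{\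 \Phi\ }\mathrm{Sym}(M_{\alpha,d})\to 1$$ that is right split. -/

import Mathlib

open scoped Ordinal

universe u

noncomputable section

namespace OrdinalHomeo

/-- The compact ordinal `ω ^ (α + 1) * d + 1`, i.e. the set of all smaller ordinals. It carries the
subspace topology from `Ordinal`, which is its order topology (see `orderTopology_X`). -/
abbrev X (α : Ordinal.{u}) (d : ℕ) : Type (u + 1) :=
  Set.Iio (ω ^ (α + 1) * (d : Ordinal.{u}) + 1)

theorem orderTopology_X (α : Ordinal.{u}) (d : ℕ) : OrderTopology (X α d) := inferInstance

instance compactSpace_X (α : Ordinal.{u}) (d : ℕ) : CompactSpace (X α d) := by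
  have h : Set.Iio (ω ^ (α + 1) * (d : Ordinal.{u}) + 1) =
      Set.Icc 0 (ω ^ (α + 1) * (d : Ordinal.{u})) := by
    ext x
    simp [Order.lt_add_one_iff]
  apply isCompact_iff_compactSpace.mp
  rw [h]
  exact isCompact_Icc

/-- The homeomorphism group of `ω ^ (α + 1) * d + 1`; the product is composition. -/
abbrev H (α : Ordinal.{u}) (d : ℕ) : Type (u + 1) := X α d ≃ₜ X α d

/-- The compact-open topology on the homeomorphism group. -/
instance compactOpenH (α : Ordinal.{u}) (d : ℕ) : TopologicalSpace (H α d) :=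
  TopologicalSpace.induced (fun h : H α d => (h : C(X α d, X α d))) ContinuousMap.compactOpen

theorem continuous_toContinuousMap (α : Ordinal.{u}) (d : ℕ) :
    Continuous (fun h : H α d => (h : C(X α d, X α d))) :=
  continuous_induced_dom

instance isTopologicalGroup_H (α : Ordinal.{u}) (d : ℕ) : IsTopologicalGroup (H α d) where
  continuous_mul := by
    refine continuous_induced_rng.mpr ?_
    exact ContinuousMap.continuous_comp'.comp
      (((continuous_toContinuousMap α d).comp continuous_snd).prodMk
        ((continuous_toContinuousMap α d).comp continuous_fst))
  continuous_inv := by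
    refine continuous_induced_rng.mpr (ContinuousMap.continuous_compactOpen.mpr ?_)
    intro K hK W hW
    have h : {h : H α d | Set.MapsTo
        (((fun h : H α d => (h : C(X α d, X α d))) ∘ fun h : H α d => h⁻¹) h) K W} =
        (fun h : H α d => (h : C(X α d, X α d))) ⁻¹' {f | Set.MapsTo f Wᶜ Kᶜ} := by
      ext h
      constructor
      · intro hh x hx hxK
        exact hx (by simpa using hh hxK)
      · intro hh x hx
        by_contra hxW
        exact hh hxW (by simpa using hx)
    rw [h]
    exact (ContinuousMap.isOpen_setOfPred_mapsTo hW.isClosed_compl.isCompact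
      hK.isClosed.isOpen_compl).preimage (continuous_toContinuousMap α d)

/-- The point `μ_k = ω ^ (α + 1) * k`, used for `1 ≤ k ≤ d`. -/
def mu (α : Ordinal.{u}) (d k : ℕ) (hk : k ≤ d) : X α d :=
  ⟨ω ^ (α + 1) * (k : Ordinal.{u}),
    Set.mem_Iio.mpr (Order.lt_add_one_iff.mpr (mul_le_mul_right (Nat.cast_le.mpr hk) _))⟩

/-- The set `{μ_1, …, μ_d}` of points of maximal rank. -/
def M (α : Ordinal.{u}) (d : ℕ) : Set (X α d) :=
  {x | ∃ (k : ℕ) (hk : k ≤ d), 1 ≤ k ∧ x = mu α d k hk}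

/-- The set of points of next-to-maximal Cantor-Bendixson rank. These are the points
`ω ^ (α + 1) * k + ω ^ α * l` with `k < d` and `1 ≤ l`; for `α = 0` they are the isolated points,
so that the point `0` belongs to them as well. -/
def N (α : Ordinal.{u}) (d : ℕ) : Set (X α d) :=
  {x | (∃ k l : ℕ, k < d ∧ 1 ≤ l ∧
      (x : Ordinal.{u}) = ω ^ (α + 1) * (k : Ordinal.{u}) + ω ^ α * (l : Ordinal.{u})) ∨
    (α = 0 ∧ (x : Ordinal.{u}) = 0)}

/-- The homeomorphisms that induce a finitely supported permutation of `N`. (Every homeomorphism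
maps `N` onto itself.) -/
def F (α : Ordinal.{u}) (d : ℕ) : Subgroup (H α d) where
  carrier := {h | {x | x ∈ N α d ∧ h x ≠ x}.Finite}
  one_mem' := by simp
  mul_mem' := by
    intro g h hg hh
    refine (hg.union hh).subset ?_
    rintro x ⟨hx, hne⟩
    by_cases hhx : h x = x
    · left
      refine ⟨hx, fun hgx => hne ?_⟩
      change g (h x) = x
      rw [hhx, hgx]
    · exact Or.inr ⟨hx, hhx⟩
  inv_mem' := by
    intro h hh
    refine Set.Finite.subset hh ?_
    rintro x ⟨hx, hne⟩
    refine ⟨hx, fun hhx => hne ?_⟩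
    change h.symm x = x
    rw [Homeomorph.symm_apply_eq, hhx]

/-- The closure of `F` in the compact-open topology. -/
def Fbar (α : Ordinal.{u}) (d : ℕ) : Subgroup (H α d) := (F α d).topologicalClosure

/-- The pure homeomorphism group: the homeomorphisms fixing every point of maximal rank. -/
def PH (α : Ordinal.{u}) (d : ℕ) : Subgroup (H α d) where
  carrier := {h | ∀ x ∈ M α d, h x = x}
  one_mem' := fun _ _ => rfl
  mul_mem' := by
    intro g h hg hh x hx
    change g (h x) = x
    rw [hh x hx, hg x hx]
  inv_mem' := by
    intro h hh x hx
    change h.symm x = x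
    rw [Homeomorph.symm_apply_eq, hh x hx]

/-- `Ω` is a family of pairwise disjoint clopen neighbourhoods of `μ_1, …, μ_{d-1}`
(`Ω i` belongs to `μ_{i+1}`), none of which contains `μ_d`. -/
structure IsSeparating (α : Ordinal.{u}) (d : ℕ) (Ω : Fin (d - 1) → Set (X α d)) : Prop where
  isClopen : ∀ i, IsClopen (Ω i)
  mem : ∀ i : Fin (d - 1), mu α d (i + 1) (by omega) ∈ Ω i
  not_mem : ∀ i, mu α d d le_rfl ∉ Ω i
  disjoint : Pairwise fun i j => Disjoint (Ω i) (Ω j)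

/-- The points of `N` that `h` moves out of `U`. -/
def outSet (α : Ordinal.{u}) (d : ℕ) (U : Set (X α d)) (h : H α d) : Set (X α d) :=
  {x | x ∈ N α d ∧ x ∈ U ∧ h x ∉ U}

/-- The points of `N` that `h` moves into `U`. -/
def inSet (α : Ordinal.{u}) (d : ℕ) (U : Set (X α d)) (h : H α d) : Set (X α d) :=
  {x | x ∈ N α d ∧ x ∉ U ∧ h x ∈ U}

/-- The flux of `h` out of `U` is defined and equal to `n`: only finitely many points of `N` are
moved out of `U` or into `U`, and `n` is the difference of their numbers. -/
structure HasFlux (α : Ordinal.{u}) (d : ℕ) (U : Set (X α d)) (h : H α d) (n : ℤ) : Prop where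
  finite_out : (outSet α d U h).Finite
  finite_in : (inSet α d U h).Finite
  eq : n = ((outSet α d U h).ncard : ℤ) - ((inSet α d U h).ncard : ℤ)

end OrdinalHomeo

end

/-! A nonzero ordinal survives `β` Cantor–Bendixson derivatives exactly when `ω ^ β` divides it
(`Ordinal.mem_cbLevel_iff`). Hence `M` is the level `α + 1` and `N` is the rest of the level `α`,
and all homeomorphisms preserve both. Since `M` is finite and `X` is compact, a clopen set missing
`M` has only finitely many points of `N`. So if `h` fixes `M` pointwise and `U` is clopen, then `N ∩
U` and `N ∩ h ⁻¹' U` differ in finitely many points. Their signed difference is the flux: it is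
additive in `h` and depends on `U` only through `U ∩ M`.

The flux vanishes on `F` and, being determined by `h ⁻¹' U`, on the closure of `F`. Conversely, let
`h` have zero flux. A neighbourhood of `h` is controlled by a finite clopen partition. Each class
and its image under `h` contain the same points of `M` and balanced points of `N`. Clopen sets
missing `M` with the same nonzero number of points of `N` are homeomorphic
(`nonempty_homeomorph_of_isClopen`), so an element of `F` can move the classes as `h` does. Only `d
- 1` fluxes are needed because the total flux over a partition is zero.

For the splittings, `X` is the point `0` and `d` columns, each the one-point compactification of a
sequence of blocks `(0, ω ^ α]`. Arranging the blocks into `d - 1` two-sided sequences lets `ℤ ^ (d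
- 1)` act by translations with prescribed flux; permuting whole columns splits the action on `M`. -/

noncomputable section

open Set Filter Topology Order

open scoped OnePoint

/-! ### Cantor–Bendixson derivatives of topological spaces -/

/-- The `β`-th Cantor-Bendixson derivative of a topological space. -/
def cbLevel (Y : Type*) [TopologicalSpace Y] (β : Ordinal.{u}) : Set Y :=
  {x | ∀ γ, γ < β → AccPt x (𝓟 (cbLevel Y γ))}
termination_by β

theorem mem_cbLevel {Y : Type*} [TopologicalSpace Y] {β : Ordinal.{u}} {x : Y} :
    x ∈ cbLevel Y β ↔ ∀ γ < β, AccPt x (𝓟 (cbLevel Y γ)) := by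
  rw [cbLevel]; rfl

theorem cbLevel_antitone (Y : Type*) [TopologicalSpace Y] :
    Antitone (cbLevel.{u} Y) := fun _ _ h _ hx =>
  mem_cbLevel.2 fun γ hγ => mem_cbLevel.1 hx γ (hγ.trans_le h)

theorem mem_cbLevel_add_one {Y : Type*} [TopologicalSpace Y] {β : Ordinal.{u}} {x : Y} :
    x ∈ cbLevel Y (β + 1) ↔ AccPt x (𝓟 (cbLevel Y β)) := by
  rw [mem_cbLevel]
  refine ⟨fun h => h β (lt_add_one β), fun h γ hγ => h.mono ?_⟩
  exact principal_mono.2 (cbLevel_antitone Y (Order.lt_add_one_iff.1 hγ))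

/-- Accumulation is a local notion, hence so is rank. This moves ranks between `Ordinal`, `X`, its
clopen subsets and intervals. -/
theorem Topology.IsOpenEmbedding.mem_cbLevel_iff {Y Z : Type*} [TopologicalSpace Y]
    [TopologicalSpace Z] {e : Y → Z} (he : IsOpenEmbedding e) (β : Ordinal.{u}) {y : Y} :
    e y ∈ cbLevel Z β ↔ y ∈ cbLevel Y β := by
  induction β using WellFoundedLT.induction generalizing y with
  | ind β ih =>
    rw [mem_cbLevel, mem_cbLevel]
    refine forall₂_congr fun γ hγ => ?_
    rw [← he.accPt_comap_iff, comap_principal]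
    have : e ⁻¹' cbLevel Z γ = cbLevel Y γ := by
      ext y
      exact ih γ hγ
    rw [this]

theorem Homeomorph.mem_cbLevel_iff {Y Z : Type*} [TopologicalSpace Y]
    [TopologicalSpace Z] (e : Y ≃ₜ Z) (β : Ordinal.{u}) {y : Y} :
    e y ∈ cbLevel Z β ↔ y ∈ cbLevel Y β :=
  e.isOpenEmbedding.mem_cbLevel_iff β

/-! ### Ranks of ordinals -/

namespace Ordinal

/-- Here `γ` is the last exponent of the Cantor normal form, reached by recursion on the remainder
modulo the leading power. -/
theorem exists_eq_omega0_opow_mul_add_one (x : Ordinal.{u}) (hx : x ≠ 0) :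
    ∃ γ q : Ordinal.{u}, x = ω ^ γ * (q + 1) := by
  induction x using WellFoundedLT.induction with
  | ind x ih =>
    have hdm := div_add_mod x (ω ^ log ω x)
    by_cases hr : x % ω ^ log ω x = 0
    · rw [hr, add_zero] at hdm
      have h1 := div_opow_log_lt x one_lt_omega0
      obtain ⟨n, hn⟩ := lt_omega0.1 h1
      have h2 := div_opow_log_pos ω hx
      rw [hn] at h2 hdm
      cases n with
      | zero => simp at h2
      | succ n => exact ⟨log ω x, n, by rw [← Nat.cast_add_one]; exact hdm.symm⟩
    · obtain ⟨γ, q, hq⟩ := ih _ (mod_opow_log_lt_self ω hx) hr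
      have hle : ω ^ γ < ω ^ log ω x := by
        refine lt_of_le_of_lt ?_ (mod_lt x (opow_ne_zero _ omega0_ne_zero))
        rw [hq]
        exact le_mul_of_one_le_right zero_le (le_add_of_nonneg_left zero_le)
      obtain ⟨δ, hδ⟩ := opow_dvd_opow ω ((opow_lt_opow_iff_right one_lt_omega0).1 hle).le
      refine ⟨γ, δ * (x / ω ^ log ω x) + q, ?_⟩
      conv_lhs => rw [← hdm, hq]
      rw [add_assoc (δ * _), mul_add (ω ^ γ) (δ * _), ← mul_assoc, ← hδ]

/-- If `β > γ`, cancelling `ω ^ γ` would leave `ω ∣ q + 1`, but a multiple of `ω` is never a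
successor. -/
theorem omega0_opow_dvd_mul_add_one_iff {β γ q : Ordinal.{u}} :
    ω ^ β ∣ ω ^ γ * (q + 1) ↔ β ≤ γ := by
  refine ⟨fun h => ?_, fun h => (opow_dvd_opow ω h).mul_right _⟩
  by_contra! hlt
  have h1 : ω ^ (γ + 1) ∣ ω ^ γ * (q + 1) :=
    (opow_dvd_opow ω (Order.add_one_le_of_lt hlt)).trans h
  rw [opow_add_one] at h1
  obtain ⟨c, hc⟩ := h1
  rw [mul_assoc] at hc
  have h2 := mul_left_cancel₀ (opow_ne_zero γ omega0_ne_zero) hc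
  have h3 : ω ∣ q + 1 := ⟨c, h2⟩
  rw [← isSuccPrelimit_iff_omega0_dvd] at h3
  simp at h3

/-- Write `x = ω ^ γ * (q + 1)`. No multiple of `ω ^ γ` lies strictly between `ω ^ γ * q` and `x`,
so the rank is at most `γ`. For `δ < γ`, `x` is a multiple of `ω ^ (δ + 1)`, hence a limit of
multiples of `ω ^ δ`. The point `0` is excluded: every power divides it, yet it is isolated. -/
theorem mem_cbLevel_iff {β x : Ordinal.{u}} (hx : x ≠ 0) :
    x ∈ cbLevel Ordinal.{u} β ↔ ω ^ β ∣ x := by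
  induction β using WellFoundedLT.induction generalizing x with
  | ind β ih =>
    rw [mem_cbLevel]
    obtain ⟨γ, q, rfl⟩ := exists_eq_omega0_opow_mul_add_one x hx
    rw [omega0_opow_dvd_mul_add_one_iff]
    have hpos : ∀ δ : Ordinal.{u}, ω ^ δ ≠ 0 := fun δ => opow_ne_zero δ omega0_ne_zero
    constructor
    · intro h
      by_contra! hlt
      obtain ⟨y, hy, hy1, hy2⟩ := (SuccOrder.accPt_principal.1 (h γ hlt)).2 (ω ^ γ * q)
        (by rw [mul_add_one]; exact lt_add_of_pos_right _ (pos_iff_ne_zero.2 (hpos γ)))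
      rw [ih γ hlt (ne_bot_of_gt hy1)] at hy
      obtain ⟨c, rfl⟩ := hy
      rw [mul_lt_mul_iff_right₀ (pos_iff_ne_zero.2 (hpos γ))] at hy1 hy2
      exact absurd (Order.add_one_le_of_lt hy1) (not_le.2 hy2)
    · intro h δ hδ
      rw [SuccOrder.accPt_principal]
      refine ⟨by simp [isMin_iff_eq_bot], fun a ha => ?_⟩
      have hd : ω ^ (δ + 1) ∣ ω ^ γ * (q + 1) :=
        (opow_dvd_opow ω (Order.add_one_le_of_lt (hδ.trans_le h))).mul_right _
      obtain ⟨c, hc⟩ := hd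
      rw [opow_add_one, mul_assoc] at hc
      have hlim : IsSuccPrelimit (ω * c) := isSuccPrelimit_iff_omega0_dvd.2 ⟨c, rfl⟩
      have h1 : a / ω ^ δ < ω * c := by
        rw [← lt_mul_iff_div_lt (hpos δ), ← hc]
        exact ha
      have h2 : a / ω ^ δ + 1 < ω * c := by simpa using hlim.succ_lt h1
      have h3 : a < ω ^ δ * (a / ω ^ δ + 1) := by
        simpa using lt_mul_succ_div a (hpos δ)
      refine ⟨ω ^ δ * (a / ω ^ δ + 1), ?_, h3, ?_⟩
      · exact (ih δ hδ (ne_bot_of_gt h3)).2 (dvd_mul_right _ _)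
      · rw [hc]
        exact (mul_lt_mul_iff_right₀ (pos_iff_ne_zero.2 (hpos δ))).2 h2

theorem zero_mem_cbLevel_iff {β : Ordinal.{u}} :
    (0 : Ordinal.{u}) ∈ cbLevel Ordinal.{u} β ↔ β = 0 := by
  rw [mem_cbLevel]
  constructor
  · intro h
    by_contra hβ
    exact (h 0 (pos_iff_ne_zero.2 hβ)).not_isMin (by simp [isMin_iff_eq_bot])
  · rintro rfl γ hγ
    exact absurd hγ (not_lt_bot)

end Ordinal

/-! ### Topological description of `M` and `N` -/

namespace OrdinalHomeo

variable {α : Ordinal.{u}} {d : ℕ}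

theorem isOpenEmbedding_val : IsOpenEmbedding (Subtype.val : X α d → Ordinal.{u}) :=
  isOpen_Iio.isOpenEmbedding_subtypeVal

theorem mem_cbLevel_iff {β : Ordinal.{u}} {x : X α d} :
    x ∈ cbLevel (X α d) β ↔ (x : Ordinal.{u}) ∈ cbLevel Ordinal.{u} β :=
  (isOpenEmbedding_val.mem_cbLevel_iff β).symm

theorem omega0_opow_pos (β : Ordinal.{u}) : 0 < ω ^ β :=
  Ordinal.opow_pos β Ordinal.omega0_pos

theorem M_eq_cbLevel : M α d = cbLevel (X α d) (α + 1) := by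
  ext x
  rw [mem_cbLevel_iff]
  constructor
  · rintro ⟨k, hk, h1, rfl⟩
    have h0 : ω ^ (α + 1) * (k : Ordinal.{u}) ≠ 0 :=
      mul_ne_zero (omega0_opow_pos _).ne' (by exact_mod_cast (by omega : k ≠ 0))
    exact (Ordinal.mem_cbLevel_iff h0).2 (dvd_mul_right _ _)
  · intro hx
    have h0 : (x : Ordinal.{u}) ≠ 0 := by
      intro h0
      rw [h0, Ordinal.zero_mem_cbLevel_iff] at hx
      simp at hx
    obtain ⟨c, hc⟩ := (Ordinal.mem_cbLevel_iff h0).1 hx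
    have hle : (x : Ordinal.{u}) ≤ ω ^ (α + 1) * d := Order.lt_add_one_iff.1 x.2
    rw [hc, mul_le_mul_iff_right₀ (omega0_opow_pos _)] at hle
    obtain ⟨k, rfl⟩ := Ordinal.lt_omega0.1 (hle.trans_lt (Ordinal.natCast_lt_omega0 d))
    refine ⟨k, by exact_mod_cast hle, ?_, Subtype.ext hc⟩
    rcases Nat.eq_zero_or_pos k with rfl | h
    · simp [hc] at h0
    · exact h

theorem N_eq_cbLevel : N α d = cbLevel (X α d) α \ cbLevel (X α d) (α + 1) := by
  ext x
  rw [Set.mem_sdiff, mem_cbLevel_iff, mem_cbLevel_iff]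
  constructor
  · rintro (⟨k, l, hk, hl, hx⟩ | ⟨rfl, hx⟩)
    -- Splitting off `1` from `l` exhibits a successor cofactor, so the last exponent is exactly
    -- `α`.
    · have hx' : (x : Ordinal.{u}) = ω ^ α * (ω * k + (l - 1 : ℕ) + 1) := by
        rw [hx, add_assoc, mul_add, Ordinal.opow_add_one, mul_assoc]
        congr 2
        exact_mod_cast (Nat.sub_add_cancel hl).symm
      have h0 : (x : Ordinal.{u}) ≠ 0 := by
        rw [hx']
        exact mul_ne_zero (omega0_opow_pos _).ne' (by simp)
      rw [Ordinal.mem_cbLevel_iff h0, Ordinal.mem_cbLevel_iff h0, hx',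
        Ordinal.omega0_opow_dvd_mul_add_one_iff, Ordinal.omega0_opow_dvd_mul_add_one_iff]
      simp
    · rw [hx, Ordinal.zero_mem_cbLevel_iff, Ordinal.zero_mem_cbLevel_iff]
      simp
  · rintro ⟨h1, h2⟩
    by_cases h0 : (x : Ordinal.{u}) = 0
    · rw [h0, Ordinal.zero_mem_cbLevel_iff] at h1
      exact Or.inr ⟨h1, h0⟩
    · left
      rw [Ordinal.mem_cbLevel_iff h0] at h1 h2
      obtain ⟨c, hc⟩ := h1
      have hle : (x : Ordinal.{u}) ≤ ω ^ (α + 1) * d := Order.lt_add_one_iff.1 x.2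
      rw [hc, Ordinal.opow_add_one, mul_assoc, mul_le_mul_iff_right₀ (omega0_opow_pos _)] at hle
      rw [hc, Ordinal.opow_add_one] at h2
      have hlt : c < ω * d := by
        refine lt_of_le_of_ne hle ?_
        rintro rfl
        exact h2 (mul_dvd_mul_left _ (dvd_mul_right _ _))
      obtain ⟨q, hq, r, hr, rfl⟩ := Ordinal.lt_mul_iff.1 hlt
      obtain ⟨k, rfl⟩ := Ordinal.lt_omega0.1 (hq.trans (Ordinal.natCast_lt_omega0 d))
      obtain ⟨l, rfl⟩ := Ordinal.lt_omega0.1 hr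
      refine ⟨k, l, by exact_mod_cast hq, ?_, by
        rw [hc, mul_add, Ordinal.opow_add_one, mul_assoc]⟩
      rcases Nat.eq_zero_or_pos l with rfl | h
      · refine absurd ?_ h2
        rw [Nat.cast_zero, add_zero]
        exact mul_dvd_mul_left _ (dvd_mul_right _ _)
      · exact h

theorem apply_mem_M (h : H α d) {x : X α d} : h x ∈ M α d ↔ x ∈ M α d := by
  rw [M_eq_cbLevel]
  exact h.mem_cbLevel_iff _

theorem apply_mem_N (h : H α d) {x : X α d} : h x ∈ N α d ↔ x ∈ N α d := by
  rw [N_eq_cbLevel]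
  exact and_congr (h.mem_cbLevel_iff _) (not_congr (h.mem_cbLevel_iff _))

theorem notMem_M_of_mem_N {x : X α d} (hx : x ∈ N α d) : x ∉ M α d := by
  rw [N_eq_cbLevel] at hx
  rw [M_eq_cbLevel]
  exact hx.2

theorem finite_M : (M α d).Finite := by
  refine (Set.finite_range fun k : Fin (d + 1) => mu α d k (Nat.lt_succ_iff.1 k.2)).subset ?_
  rintro x ⟨k, hk, -, rfl⟩
  exact ⟨⟨k, Nat.lt_succ_of_le hk⟩, rfl⟩

/-- A point of `M` is an accumulation point of the level `α`, which lies in `N ∪ M`; the finite set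
`M` cannot be responsible. -/
theorem accPt_N {x : X α d} (hx : x ∈ M α d) : AccPt x (𝓟 (N α d)) := by
  have h1 : AccPt x (𝓟 (cbLevel (X α d) α)) := by
    rw [M_eq_cbLevel] at hx
    exact mem_cbLevel_add_one.1 hx
  have h2 : cbLevel (X α d) α ⊆ N α d ∪ M α d := by
    rw [N_eq_cbLevel, M_eq_cbLevel, sdiff_union_self]
    exact subset_union_left
  have h3 := h1.mono (principal_mono.2 h2)
  rw [← sup_principal, accPt_sup] at h3
  refine h3.resolve_right fun h => ?_
  exact Set.Infinite.of_accPt h finite_M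

/-- A closed set without points of maximal rank has finitely many points of next-to-maximal rank. -/
theorem finite_N_inter {C : Set (X α d)} (hC : IsClosed C) (hCM : Disjoint C (M α d)) :
    (N α d ∩ C).Finite := by
  by_contra hinf
  -- An infinite set would accumulate in the compact set `C`, at a point of rank at least `α + 1`.
  obtain ⟨x, hxC, hx⟩ :=
    Set.Infinite.exists_accPt_of_subset_isCompact hinf hC.isCompact inter_subset_right
  refine Set.disjoint_left.1 hCM hxC ?_
  rw [M_eq_cbLevel, mem_cbLevel_add_one]
  refine hx.mono (principal_mono.2 ?_)
  rw [N_eq_cbLevel]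
  exact inter_subset_left.trans sdiff_subset

/-- Initial segments are clopen. With compactness this provides the clopen sets used in the exchange
and approximation arguments. -/
instance totallySeparatedSpace_X : TotallySeparatedSpace (X α d) := by
  rw [totallySeparatedSpace_iff_exists_isClopen]
  have key : ∀ x : X α d, IsClopen (Set.Iic x) := by
    intro x
    refine ⟨isClosed_Iic, ?_⟩
    have : Set.Iic x = Subtype.val ⁻¹' Set.Iio ((x : Ordinal.{u}) + 1) := by
      ext y
      simp [Order.lt_add_one_iff]
    rw [this]
    exact isOpen_Iio.preimage continuous_subtype_val
  intro x y hxy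
  rcases lt_or_gt_of_ne hxy with h | h
  · exact ⟨Set.Iic x, key x, Set.mem_Iic.2 le_rfl, not_le.2 h⟩
  · exact ⟨(Set.Iic y)ᶜ, (key y).compl, not_le.2 h, by simp⟩

end OrdinalHomeo

/-! ### Classification of compact sets of ordinals by rank and multiplicity -/

namespace Ordinal

instance compactSpace_Ioc (a b : Ordinal.{u}) : CompactSpace (Ioc a b) := by
  have h : Ioc a b = Icc (a + 1) b := by
    ext x
    simp [Order.add_one_le_iff]
  apply isCompact_iff_compactSpace.mp
  rw [h]
  exact isCompact_Icc

theorem isOpen_Ioc (a b : Ordinal.{u}) : IsOpen (Ioc a b) := by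
  have h : Ioc a b = Ioo a (b + 1) := by
    ext x
    simp [Order.lt_add_one_iff]
  rw [h]
  exact isOpen_Ioo

theorem continuous_add_left (a : Ordinal.{u}) : Continuous fun x : Ordinal.{u} => a + x :=
  (isNormal_add_right a).continuous

/-- The interval `(0, a + b]` is the disjoint union of copies of `(0, a]` and `(0, b]`. -/
def sumIocHomeomorph (a b : Ordinal.{u}) : Ioc 0 a ⊕ Ioc 0 b ≃ₜ Ioc 0 (a + b) := by
  let f : Ioc 0 a ⊕ Ioc 0 b → Ioc 0 (a + b) := Sum.elim
    (fun x => ⟨x, x.2.1, x.2.2.trans le_self_add⟩)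
    (fun x => ⟨a + x, x.2.1.trans_le le_add_self, add_le_add_right x.2.2 a⟩)
  have hf : Continuous f := by
    refine Continuous.sumElim ?_ ?_
    · exact continuous_subtype_val.subtype_mk _
    · exact ((continuous_add_left a).comp continuous_subtype_val).subtype_mk _
  have hlt : ∀ (x : Ioc 0 a) (y : Ioc 0 b), (x : Ordinal.{u}) < a + y := fun x y =>
    x.2.2.trans_lt (lt_add_of_pos_right a y.2.1)
  have hb : Function.Bijective f := by
    constructor
    · rintro (x | x) (y | y) h
      · have h' := congrArg Subtype.val h
        exact congrArg Sum.inl (Subtype.ext h')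
      · exact absurd (congrArg Subtype.val h) (hlt x y).ne
      · exact absurd (congrArg Subtype.val h) (hlt y x).ne'
      · exact congrArg Sum.inr (Subtype.ext (add_left_cancel (congrArg Subtype.val h)))
    · rintro ⟨y, hy0, hy⟩
      rcases le_or_gt y a with h | h
      · exact ⟨Sum.inl ⟨y, hy0, h⟩, rfl⟩
      · have hs : a + (y - a) = y := Ordinal.add_sub_cancel_of_le h.le
        refine ⟨Sum.inr ⟨y - a, ?_, ?_⟩, Subtype.ext hs⟩
        · rw [pos_iff_ne_zero]
          intro h0
          rw [h0, add_zero] at hs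
          exact h.ne hs
        · rw [← hs] at hy
          exact le_of_add_le_add_left hy
  exact Continuous.homeoOfEquivCompactToT2 (f := Equiv.ofBijective f hb) hf

/-- Exchange the two summands of the interval: `ρ + ω ^ β * n = ω ^ β * n`, since a remainder below
`ω ^ β` is absorbed from the left. -/
theorem nonempty_homeomorph_Ioc_mul {β ρ : Ordinal.{u}} (hρ : ρ < ω ^ β) {n : ℕ} (hn : n ≠ 0) :
    Nonempty (Ioc 0 (ω ^ β * (n : Ordinal.{u}) + ρ) ≃ₜ Ioc 0 (ω ^ β * (n : Ordinal.{u}))) := by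
  have h : ρ + ω ^ β * (n : Ordinal.{u}) = ω ^ β * n := by
    obtain ⟨m, rfl⟩ := Nat.exists_eq_succ_of_ne_zero hn
    have hm : ((m.succ : ℕ) : Ordinal.{u}) = 1 + m := by
      rw [← Nat.cast_one, ← Nat.cast_add, Nat.succ_eq_one_add]
    rw [hm, mul_add, mul_one, ← add_assoc, add_of_omega0_opow_le hρ le_rfl]
  have e := ((sumIocHomeomorph (ω ^ β * (n : Ordinal.{u})) ρ).symm.trans
    (Homeomorph.sumComm _ _)).trans (sumIocHomeomorph ρ (ω ^ β * (n : Ordinal.{u})))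
  rw [h] at e
  exact ⟨e⟩

/-- Every nonempty compact set of ordinals is homeomorphic to an interval `(0, η]`. -/
theorem exists_homeomorph_Ioc {V : Set Ordinal.{u}} (hV : IsCompact V) (hne : V.Nonempty) :
    ∃ η : Ordinal.{u}, Nonempty (V ≃ₜ Ioc 0 η) := by
  obtain ⟨m, hmV, hm⟩ := hV.exists_isGreatest hne
  -- Adding everything above the maximum of `V` makes the set unbounded, so it is enumerated by all
  -- ordinals, with `V` as an initial segment.
  set S : Set Ordinal.{u} := V ∪ Ioi m with hS
  have hSb : ¬ BddAbove S := by
    rintro ⟨b, hb⟩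
    have h1 : max b m + 1 ∈ S := Or.inr (Set.mem_Ioi.2 (Order.lt_add_one_iff.2 (le_max_right _ _)))
    exact absurd (hb h1) (not_le.2 (Order.lt_add_one_iff.2 (le_max_left _ _)))
  let e : Ordinal.{u} ≃o S := enumOrdOrderIso S hSb
  let i : V → S := fun v => ⟨v, Or.inl v.2⟩
  let m' : S := ⟨m, Or.inl hmV⟩
  -- The enumeration starts at `0`, which the interval omits. Adding `1` on the left is continuous,
  -- unlike taking successors.
  let f : V → Ioc (0 : Ordinal.{u}) (1 + e.symm m') := fun v => ⟨1 + e.symm (i v),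
    zero_lt_one.trans_le le_self_add, add_le_add_right (e.symm.monotone (hm v.2)) 1⟩
  have hcont : Continuous fun v : V => e.symm (i v) := by
    rw [OrderTopology.continuous_iff]
    intro a
    have h1 : (fun v : V => e.symm (i v)) ⁻¹' Ioi a = Subtype.val ⁻¹' Ioi (e a : Ordinal.{u}) := by
      ext v
      exact e.lt_symm_apply
    have h2 : (fun v : V => e.symm (i v)) ⁻¹' Iio a = Subtype.val ⁻¹' Iio (e a : Ordinal.{u}) := by
      ext v
      exact e.symm_apply_lt
    rw [h1, h2]
    exact ⟨isOpen_Ioi.preimage continuous_subtype_val, isOpen_Iio.preimage continuous_subtype_val⟩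
  have hf : Continuous f := ((continuous_add_left 1).comp hcont).subtype_mk _
  have hb : Function.Bijective f := by
    constructor
    · intro v w h
      have h1 := e.symm.injective (add_left_cancel (congrArg Subtype.val h))
      have h2 := congrArg Subtype.val h1
      exact Subtype.ext h2
    · rintro ⟨y, hy0, hy⟩
      have hs : 1 + (y - 1) = y :=
        Ordinal.add_sub_cancel_of_le (Order.one_le_iff_pos.2 hy0)
      have h1 : y - 1 ≤ e.symm m' := by
        rw [← hs] at hy
        exact le_of_add_le_add_left hy
      have h2 : e (y - 1) ≤ m' := e.le_symm_apply.1 h1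
      have h3 : (e (y - 1) : Ordinal.{u}) ∈ V :=
        (e (y - 1)).2.resolve_right fun h => absurd h (not_lt.2 h2)
      refine ⟨⟨e (y - 1), h3⟩, Subtype.ext ?_⟩
      change 1 + e.symm (e (y - 1)) = y
      rw [e.symm_apply_apply, hs]
  have : CompactSpace V := isCompact_iff_compactSpace.1 hV
  exact ⟨_, ⟨Continuous.homeoOfEquivCompactToT2 (f := Equiv.ofBijective f hb) hf⟩⟩

theorem cbLevel_Ioc {β η : Ordinal.{u}} {x : Ioc 0 η} :
    x ∈ cbLevel (Ioc 0 η) β ↔ ω ^ β ∣ (x : Ordinal.{u}) := by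
  rw [← mem_cbLevel_iff x.2.1.ne', ← (isOpen_Ioc 0 η).isOpenEmbedding_subtypeVal.mem_cbLevel_iff]

theorem ncard_cbLevel_Ioc {β ρ : Ordinal.{u}} (hρ : ρ < ω ^ β) (n : ℕ) :
    (cbLevel (Ioc 0 (ω ^ β * (n : Ordinal.{u}) + ρ)) β).ncard = n := by
  have hpos : 0 < ω ^ β := opow_pos β omega0_pos
  let g : Fin n → Ioc 0 (ω ^ β * (n : Ordinal.{u}) + ρ) := fun k =>
    ⟨ω ^ β * ((k + 1 : ℕ) : Ordinal.{u}), mul_pos hpos (by exact_mod_cast Nat.succ_pos _),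
      (mul_le_mul_right (by exact_mod_cast k.2) _).trans le_self_add⟩
  have hg : Function.Injective g := by
    intro k l h
    have h1 := mul_left_cancel₀ hpos.ne' (congrArg Subtype.val h)
    have h2 : (k : ℕ) + 1 = l + 1 := by exact_mod_cast h1
    exact Fin.ext (by omega)
  have hr : range g = cbLevel (Ioc 0 (ω ^ β * (n : Ordinal.{u}) + ρ)) β := by
    ext x
    rw [cbLevel_Ioc]
    constructor
    · rintro ⟨k, rfl⟩
      exact dvd_mul_right _ _
    · rintro ⟨c, hc⟩
      have hx := x.2.2
      have hlt : c < n + 1 := by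
        rw [← mul_lt_mul_iff_right₀ hpos, ← hc, mul_add_one]
        exact hx.trans_lt (add_lt_add_right hρ _)
      obtain ⟨k, rfl⟩ := lt_omega0.1 ((Order.lt_add_one_iff.1 hlt).trans_lt (natCast_lt_omega0 n))
      have hk : k < n + 1 := by exact_mod_cast hlt
      have hk0 : k ≠ 0 := by
        rintro rfl
        exact x.2.1.ne' (by simp [hc])
      refine ⟨⟨k - 1, by omega⟩, Subtype.ext ?_⟩
      rw [hc]
      change ω ^ β * ((k - 1 + 1 : ℕ) : Ordinal.{u}) = _
      rw [Nat.sub_add_cancel (by omega)]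
  rw [← hr, ← image_univ, ncard_image_of_injective _ hg, ncard_univ, Nat.card_eq_fintype_card,
    Fintype.card_fin]

/-- A space homeomorphic to a compact set of ordinals, with `n ≠ 0` points of rank at least `β` and
none of higher rank, is homeomorphic to `(0, ω ^ β * n]`. -/
theorem nonempty_homeomorph_of_ncard_cbLevel {Y : Type*} [TopologicalSpace Y] {β : Ordinal.{u}}
    {V : Set Ordinal.{u}} (e : Y ≃ₜ V) (hV : IsCompact V)
    (h1 : cbLevel Y (β + 1) = ∅) (hn : (cbLevel Y β).ncard ≠ 0) :
    Nonempty (Y ≃ₜ Ioc 0 (ω ^ β * ((cbLevel Y β).ncard : Ordinal.{u}))) := by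
  have hpos : ∀ β : Ordinal.{u}, 0 < ω ^ β := fun β => opow_pos β omega0_pos
  obtain ⟨y, -⟩ := nonempty_of_ncard_ne_zero hn
  obtain ⟨η, ⟨e'⟩⟩ := exists_homeomorph_Ioc hV ⟨_, (e y).2⟩
  have E := e.trans e'
  clear e e'
  -- Otherwise `ω ^ (β + 1)` would be a point of rank `β + 1`. Hence `η = ω ^ β * n + ρ` with `n`
  -- finite, and counting the points of rank `β` identifies `n`.
  have hη : η < ω ^ (β + 1) := by
    by_contra! hle
    let z : Ioc 0 η := ⟨ω ^ (β + 1), hpos _, hle⟩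
    have h2 : z ∈ cbLevel (Ioc 0 η) (β + 1) := cbLevel_Ioc.2 dvd_rfl
    rw [← E.symm.mem_cbLevel_iff, h1] at h2
    exact h2
  rw [opow_add_one] at hη
  obtain ⟨c, hc, ρ, hρ, rfl⟩ := lt_mul_iff.1 hη
  obtain ⟨n, rfl⟩ := lt_omega0.1 hc
  have hcard : (cbLevel Y β).ncard = n := by
    rw [← ncard_cbLevel_Ioc hρ n, ← ncard_image_of_injective _ E.injective]
    congr 1
    ext x
    rw [← E.symm.mem_cbLevel_iff]
    exact E.toEquiv.image_eq_preimage_symm (cbLevel Y β) ▸ Iff.rfl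
  rw [hcard] at hn ⊢
  obtain ⟨e2⟩ := nonempty_homeomorph_Ioc_mul hρ hn
  exact ⟨E.trans e2⟩

end Ordinal

/-! ### Homeomorphic clopen subsets of `X` -/

namespace OrdinalHomeo

variable {α : Ordinal.{u}} {d : ℕ}

theorem nonempty_homeomorph_Ioc_of_isClopen {V : Set (X α d)} (hV : IsClopen V)
    (hVM : Disjoint V (M α d)) (hn : (N α d ∩ V).ncard ≠ 0) :
    Nonempty (V ≃ₜ Ioc 0 (ω ^ α * ((N α d ∩ V).ncard : Ordinal.{u}))) := by
  have hemb := hV.isOpen.isOpenEmbedding_subtypeVal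
  have h1 : cbLevel V (α + 1) = ∅ := by
    rw [eq_empty_iff_forall_notMem]
    intro x hx
    rw [← hemb.mem_cbLevel_iff, ← M_eq_cbLevel] at hx
    exact Set.disjoint_left.1 hVM x.2 hx
  have h2 : Subtype.val '' cbLevel V α = N α d ∩ V := by
    ext x
    constructor
    · rintro ⟨y, hy, rfl⟩
      rw [← hemb.mem_cbLevel_iff] at hy
      refine ⟨?_, y.2⟩
      rw [N_eq_cbLevel, ← M_eq_cbLevel]
      exact ⟨hy, Set.disjoint_left.1 hVM y.2⟩
    · rintro ⟨hx, hxV⟩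
      refine ⟨⟨x, hxV⟩, ?_, rfl⟩
      rw [N_eq_cbLevel] at hx
      rw [← hemb.mem_cbLevel_iff]
      exact hx.1
  have h3 : (cbLevel V α).ncard = (N α d ∩ V).ncard := by
    rw [← h2, ncard_image_of_injective _ Subtype.val_injective]
  rw [← h3] at hn ⊢
  have e : V ≃ₜ (Subtype.val '' V : Set Ordinal.{u}) :=
    isOpenEmbedding_val.isEmbedding.homeomorphImage V
  exact Ordinal.nonempty_homeomorph_of_ncard_cbLevel e
    (hV.isClosed.isCompact.image continuous_subtype_val) h1 hn

/-- Clopen sets without points of maximal rank and with the same nonzero number of points of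
next-to-maximal rank are homeomorphic. -/
theorem nonempty_homeomorph_of_isClopen {V W : Set (X α d)} (hV : IsClopen V) (hW : IsClopen W)
    (hVM : Disjoint V (M α d)) (hWM : Disjoint W (M α d)) (hn : (N α d ∩ V).ncard ≠ 0)
    (h : (N α d ∩ V).ncard = (N α d ∩ W).ncard) : Nonempty (V ≃ₜ W) := by
  obtain ⟨e⟩ := nonempty_homeomorph_Ioc_of_isClopen hV hVM hn
  rw [h] at hn e
  obtain ⟨e'⟩ := nonempty_homeomorph_Ioc_of_isClopen hW hWM hn
  exact ⟨e.trans e'.symm⟩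

end OrdinalHomeo

/-! ### Relative cardinality of almost equal sets -/

/-- The difference `|A \ B| - |B \ A|`, for sets that differ in finitely many points. -/
def relCard {Y : Type*} (A B : Set Y) : ℤ :=
  ∑ᶠ x, (A.indicator 1 x - B.indicator 1 x)

section relCard

variable {Y Z : Type*} {A B C : Set Y}

theorem finite_support_indicator_sub (h : (symmDiff A B).Finite) :
    (Function.support fun x => (A.indicator 1 x - B.indicator 1 x : ℤ)).Finite := by
  refine h.subset fun x hx => ?_
  by_contra hn
  rw [Set.mem_symmDiff] at hn
  apply hx
  by_cases hA : x ∈ A <;> by_cases hB : x ∈ B <;> simp_all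

theorem finsum_indicator_one (hA : A.Finite) : ∑ᶠ x, (A.indicator 1 x : ℤ) = A.ncard := by
  have h : ∀ x, (A.indicator 1 x : ℤ) = ∑ᶠ (_ : x ∈ A), 1 := fun x => by
    by_cases hx : x ∈ A <;> simp [hx]
  simp_rw [h]
  simp [finsum_mem_eq_finite_toFinset_sum _ hA, Set.ncard_eq_toFinset_card A hA]

/-- The sum of indicator differences makes additivity and invariance formal; this recovers the
counts. For an infinite symmetric difference the sum is `0` by default. -/
theorem relCard_eq (h : (symmDiff A B).Finite) :
    relCard A B = ((A \ B).ncard : ℤ) - ((B \ A).ncard : ℤ) := by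
  have h1 : (A \ B).Finite := h.subset fun x hx => Or.inl hx
  have h2 : (B \ A).Finite := h.subset fun x hx => Or.inr hx
  rw [← finsum_indicator_one h1, ← finsum_indicator_one h2, ← finsum_sub_distrib
    (h1.subset (Set.support_indicator_subset)) (h2.subset (Set.support_indicator_subset))]
  refine finsum_congr fun x => ?_
  by_cases hA : x ∈ A <;> by_cases hB : x ∈ B <;> simp [hA, hB]

theorem relCard_self (A : Set Y) : relCard A A = 0 := by
  simp [relCard]

theorem finite_symmDiff_trans (h1 : (symmDiff A B).Finite) (h2 : (symmDiff B C).Finite) :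
    (symmDiff A C).Finite :=
  (h1.union h2).subset (symmDiff_triangle A B C)

theorem relCard_add (h1 : (symmDiff A B).Finite) (h2 : (symmDiff B C).Finite) :
    relCard A B + relCard B C = relCard A C := by
  rw [relCard, relCard, relCard, ← finsum_add_distrib (finite_support_indicator_sub h1)
    (finite_support_indicator_sub h2)]
  exact finsum_congr fun x => by ring

theorem relCard_preimage (e : Z ≃ Y) (A B : Set Y) :
    relCard (e ⁻¹' A) (e ⁻¹' B) = relCard A B :=
  finsum_comp_equiv e (f := fun x => (A.indicator 1 x - B.indicator 1 x : ℤ))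

/-- Two labellings of a set whose fibres differ in finitely many points are balanced. -/
theorem sum_relCard_fibers {Q : Type*} [Fintype Q] (S : Set Y) (p p' : Y → Q)
    (h : ∀ q, (symmDiff (S ∩ p ⁻¹' {q}) (S ∩ p' ⁻¹' {q})).Finite) :
    ∑ q, relCard (S ∩ p ⁻¹' {q}) (S ∩ p' ⁻¹' {q}) = 0 := by
  classical
  have key : ∀ (p : Y → Q) (x : Y),
      ∑ q, ((S ∩ p ⁻¹' {q}).indicator 1 x : ℤ) = S.indicator 1 x := by
    intro p x
    by_cases hx : x ∈ S <;> simp [Set.indicator_apply, hx]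
  simp only [relCard]
  rw [← finsum_sum_comm _ _ fun q _ => finite_support_indicator_sub (h q)]
  rw [← finsum_zero (α := Y)]
  refine finsum_congr fun x => ?_
  rw [Finset.sum_sub_distrib, key, key, sub_self]

end relCard

/-! ### The flux and its vanishing on the closure of `F` -/

namespace OrdinalHomeo

variable {α : Ordinal.{u}} {d : ℕ}

/-- The symmetric difference of `U` and `V` is clopen and misses `M`. -/
theorem finite_symmDiff_N {U V : Set (X α d)} (hU : IsClopen U) (hV : IsClopen V)
    (h : ∀ x ∈ M α d, x ∈ U ↔ x ∈ V) : (symmDiff (N α d ∩ U) (N α d ∩ V)).Finite := by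
  have hC : IsClopen (symmDiff U V) := (hU.diff hV).union (hV.diff hU)
  refine (finite_N_inter hC.isClosed ?_).subset ?_
  · rw [Set.disjoint_left]
    rintro x (⟨h1, h2⟩ | ⟨h1, h2⟩) hx
    · exact h2 ((h x hx).1 h1)
    · exact h2 ((h x hx).2 h1)
  · rintro x (⟨⟨h1, h2⟩, h3⟩ | ⟨⟨h1, h2⟩, h3⟩)
    · exact ⟨h1, Or.inl ⟨h2, fun h => h3 ⟨h1, h⟩⟩⟩
    · exact ⟨h1, Or.inr ⟨h2, fun h => h3 ⟨h1, h⟩⟩⟩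

/-- The number of points of next-to-maximal rank that `h` moves out of `U`, minus the number of
those that it moves into `U`. -/
def flux (U : Set (X α d)) (h : H α d) : ℤ := relCard (N α d ∩ U) (N α d ∩ h ⁻¹' U)

theorem preimage_N_inter (h : H α d) (U : Set (X α d)) :
    h ⁻¹' (N α d ∩ U) = N α d ∩ h ⁻¹' U := by
  ext x
  exact and_congr (apply_mem_N h) Iff.rfl

theorem isClopen_preimage (h : H α d) {U : Set (X α d)} (hU : IsClopen U) : IsClopen (h ⁻¹' U) :=
  hU.preimage h.continuous

theorem finite_symmDiff_preimage {U : Set (X α d)} (hU : IsClopen U) {h : H α d}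
    (hh : h ∈ PH α d) : (symmDiff (N α d ∩ U) (N α d ∩ h ⁻¹' U)).Finite :=
  finite_symmDiff_N hU (isClopen_preimage h hU) fun x hx => by rw [mem_preimage, hh x hx]

theorem hasFlux_flux {U : Set (X α d)} (hU : IsClopen U) {h : H α d} (hh : h ∈ PH α d) :
    HasFlux α d U h (flux U h) := by
  have hfin := finite_symmDiff_preimage hU hh
  have h1 : outSet α d U h = (N α d ∩ U) \ (N α d ∩ h ⁻¹' U) := by
    ext x
    simp only [outSet, Set.mem_ofPred_eq, Set.mem_sdiff, mem_inter_iff, mem_preimage]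
    tauto
  have h2 : inSet α d U h = (N α d ∩ h ⁻¹' U) \ (N α d ∩ U) := by
    ext x
    simp only [inSet, Set.mem_ofPred_eq, Set.mem_sdiff, mem_inter_iff, mem_preimage]
    tauto
  refine ⟨?_, ?_, ?_⟩
  · rw [h1]
    exact hfin.subset fun x hx => Or.inl hx
  · rw [h2]
    exact hfin.subset fun x hx => Or.inr hx
  · rw [h1, h2, flux, relCard_eq hfin]

/-- Pass from `N ∩ U` to its preimage under `g * h` through `N ∩ h ⁻¹' U`. The second comparison is
the `h`-preimage of the one defining the flux of `g`, and bijections preserve `relCard`. -/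
theorem flux_mul {U : Set (X α d)} (hU : IsClopen U) {g h : H α d} (hg : g ∈ PH α d)
    (hh : h ∈ PH α d) : flux U (g * h) = flux U g + flux U h := by
  have h1 : N α d ∩ (g * h : H α d) ⁻¹' U = h ⁻¹' (N α d ∩ g ⁻¹' U) := by
    rw [preimage_N_inter]
    rfl
  have h2 : relCard (N α d ∩ h ⁻¹' U) (N α d ∩ (g * h : H α d) ⁻¹' U) = flux U g := by
    rw [h1, ← preimage_N_inter]
    exact relCard_preimage h.toEquiv _ _
  rw [← h2, add_comm, flux, flux]
  refine (relCard_add (finite_symmDiff_preimage hU hh) ?_).symm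
  refine finite_symmDiff_trans ?_ (finite_symmDiff_preimage hU (mul_mem hg hh))
  rw [symmDiff_comm]
  exact finite_symmDiff_preimage hU hh

/-- Replacing `U` by `V` changes both terms of the comparison by the same `relCard`, as `h` is a
bijection; the corrections cancel. This is why the choice of neighbourhoods is immaterial. -/
theorem flux_congr {U V : Set (X α d)} (hU : IsClopen U) (hV : IsClopen V)
    (hUV : ∀ x ∈ M α d, x ∈ U ↔ x ∈ V) {h : H α d} (hh : h ∈ PH α d) : flux U h = flux V h := by
  have h1 := finite_symmDiff_N hU hV hUV
  have h2 := finite_symmDiff_N hV hU fun x hx => (hUV x hx).symm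
  have h3 : (symmDiff (N α d ∩ h ⁻¹' U) (N α d ∩ h ⁻¹' V)).Finite :=
    finite_symmDiff_N (isClopen_preimage h hU) (isClopen_preimage h hV) fun x hx => by
      rw [mem_preimage, mem_preimage, hh x hx]
      exact hUV x hx
  have h4 : relCard (N α d ∩ h ⁻¹' U) (N α d ∩ h ⁻¹' V) = relCard (N α d ∩ U) (N α d ∩ V) := by
    rw [← preimage_N_inter, ← preimage_N_inter]
    exact relCard_preimage h.toEquiv _ _
  have h5 := relCard_add (finite_symmDiff_preimage hU hh) h3
  have h6 := relCard_add h1 (finite_symmDiff_preimage hV hh)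
  rw [flux, flux]
  linarith

/-- The clopen interval `(ω ^ (α + 1) * i, ω ^ (α + 1) * (i + 1)]`. -/
def column (α : Ordinal.{u}) (d i : ℕ) : Set (X α d) :=
  Subtype.val ⁻¹' Ioc (ω ^ (α + 1) * (i : Ordinal.{u})) (ω ^ (α + 1) * ((i + 1 : ℕ) : Ordinal.{u}))

theorem isClopen_column (i : ℕ) : IsClopen (column α d i) :=
  IsClopen.preimage ⟨(isCompact_iff_compactSpace.2 inferInstance).isClosed, Ordinal.isOpen_Ioc _ _⟩
    continuous_subtype_val

theorem mu_mem_column {k i : ℕ} {hk : k ≤ d} : mu α d k hk ∈ column α d i ↔ k = i + 1 := by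
  change ω ^ (α + 1) * (i : Ordinal.{u}) < ω ^ (α + 1) * (k : Ordinal.{u}) ∧
    ω ^ (α + 1) * (k : Ordinal.{u}) ≤ ω ^ (α + 1) * ((i + 1 : ℕ) : Ordinal.{u}) ↔ _
  rw [mul_lt_mul_iff_right₀ (omega0_opow_pos _), mul_le_mul_iff_right₀ (omega0_opow_pos _),
    Nat.cast_lt, Nat.cast_le]
  omega

theorem IsSeparating.mu_mem_iff {Ω : Fin (d - 1) → Set (X α d)} (hΩ : IsSeparating α d Ω)
    {i : Fin (d - 1)} {k : ℕ} (hk : k ≤ d) (h1 : 1 ≤ k) :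
    mu α d k hk ∈ Ω i ↔ k = i + 1 := by
  constructor
  · intro h
    by_contra hne
    rcases hk.eq_or_lt with rfl | hlt
    · exact hΩ.not_mem i h
    · have hji : (⟨k - 1, by omega⟩ : Fin (d - 1)) ≠ i := by
        rintro rfl
        exact hne (by simp; omega)
      have h2 := hΩ.mem ⟨k - 1, by omega⟩
      simp only [Nat.sub_add_cancel h1] at h2
      exact Set.disjoint_left.1 (hΩ.disjoint hji) h2 h
  · rintro rfl
    exact hΩ.mem i

theorem mem_column_iff_of_isSeparating {Ω : Fin (d - 1) → Set (X α d)} (hΩ : IsSeparating α d Ω)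
    (i : Fin (d - 1)) {x : X α d} (hx : x ∈ M α d) : x ∈ column α d i ↔ x ∈ Ω i := by
  obtain ⟨k, hk, h1, rfl⟩ := hx
  rw [mu_mem_column, hΩ.mu_mem_iff hk h1]

/-- The flux homomorphism. -/
def fluxHom (α : Ordinal.{u}) (d : ℕ) : PH α d →* Multiplicative (Fin (d - 1) → ℤ) :=
  MonoidHom.mk' (fun h => Multiplicative.ofAdd fun i => flux (column α d i) (h : H α d))
    fun g h => by
      rw [← ofAdd_add]
      congr 1
      ext i
      exact flux_mul (isClopen_column i) g.2 h.2

theorem fluxHom_apply (h : PH α d) (i : Fin (d - 1)) :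
    Multiplicative.toAdd (fluxHom α d h) i = flux (column α d i) (h : H α d) := rfl

theorem hasFlux_fluxHom {Ω : Fin (d - 1) → Set (X α d)} (hΩ : IsSeparating α d Ω) (h : PH α d)
    (i : Fin (d - 1)) : HasFlux α d (Ω i) h (Multiplicative.toAdd (fluxHom α d h) i) := by
  rw [fluxHom_apply, flux_congr (isClopen_column i) (hΩ.isClopen i)
    (fun x hx => mem_column_iff_of_isSeparating hΩ i hx) h.2]
  exact hasFlux_flux (hΩ.isClopen i) h.2

/-- Cofinitely many points of `N` are fixed, so fixed points accumulate at every point of `M`, and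
the fixed-point set is closed. -/
theorem F_le_PH : F α d ≤ PH α d := by
  intro f hf x hx
  have h1 : AccPt x (𝓟 (N α d ∩ {y | f y = y})) := by
    have h2 := accPt_N hx
    have h3 : N α d ⊆ (N α d ∩ {y | f y = y}) ∪ {y | y ∈ N α d ∧ f y ≠ y} := fun y hy => by
      by_cases h : f y = y
      · exact Or.inl ⟨hy, h⟩
      · exact Or.inr ⟨hy, h⟩
    have h4 := h2.mono (principal_mono.2 h3)
    rw [← sup_principal, accPt_sup] at h4
    exact h4.resolve_right fun h => Set.Infinite.of_accPt h hf
  have h2 : IsClosed {y | f y = y} := isClosed_eq f.continuous continuous_id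
  exact isClosed_iff_accPt.1 h2 x (h1.mono (principal_mono.2 inter_subset_right))

theorem continuous_apply (x : X α d) : Continuous fun h : H α d => h x :=
  (continuous_eval_const (F := C(X α d, X α d)) x).comp (continuous_toContinuousMap α d)

theorem isClosed_PH : IsClosed (PH α d : Set (H α d)) := by
  have h : (PH α d : Set (H α d)) = ⋂ x ∈ M α d, {h | h x = x} := by
    ext h
    simp only [mem_iInter]
    rfl
  rw [h]
  exact isClosed_biInter fun x _ => isClosed_eq (continuous_apply x) continuous_const

theorem Fbar_le_PH : Fbar α d ≤ PH α d :=
  Subgroup.topologicalClosure_minimal _ F_le_PH isClosed_PH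

/-- Without the finite support `T`, the set `N ∩ U` becomes `f`-invariant. Comparing both `N ∩ U`
and its preimage with this invariant set gives opposite contributions. -/
theorem flux_of_mem_F {f : H α d} (hf : f ∈ F α d) {U : Set (X α d)} (hU : IsClopen U) :
    flux U f = 0 := by
  set T : Set (X α d) := {x | x ∈ N α d ∧ f x ≠ x} with hT
  have hTf : T.Finite := hf
  set A := N α d ∩ U with hA
  have h1 : f ⁻¹' (A \ T) = A \ T := by
    ext x
    by_cases hx : f x = x
    · rw [mem_preimage, hx]
    · refine iff_of_false (fun h => ?_) (fun h => h.2 ⟨h.1.1, hx⟩)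
      exact h.2 ⟨h.1.1, fun h' => hx (f.injective h')⟩
  have h2 : (symmDiff A (A \ T)).Finite := hTf.subset fun x hx => by
    rcases hx with ⟨h3, h4⟩ | ⟨h3, h4⟩
    · by_contra h5
      exact h4 ⟨h3, h5⟩
    · exact absurd h3.1 h4
  have h3 : (symmDiff (A \ T) A).Finite := by rwa [symmDiff_comm]
  have h4 : relCard (A \ T) (N α d ∩ f ⁻¹' U) = relCard (A \ T) A := by
    conv_lhs => rw [← h1, ← preimage_N_inter]
    exact relCard_preimage f.toEquiv _ _
  have h5 : (symmDiff (A \ T) (N α d ∩ f ⁻¹' U)).Finite :=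
    finite_symmDiff_trans h3 (finite_symmDiff_preimage hU (F_le_PH hf))
  rw [flux, ← relCard_add h2 h5, h4, relCard_add h2 h3, relCard_self]

theorem isOpen_setOf_mapsTo {K U : Set (X α d)} (hK : IsClosed K) (hU : IsOpen U) :
    IsOpen {g : H α d | MapsTo g K U} :=
  (ContinuousMap.isOpen_setOfPred_mapsTo hK.isCompact hU).preimage (continuous_toContinuousMap α d)

/-- Having the same preimage of `U` as `h` is an open condition, since `U` and its complement are
clopen. Some `f ∈ F` satisfies it, and the flux sees only that preimage. -/
theorem flux_of_mem_Fbar {h : H α d} (hh : h ∈ Fbar α d) {U : Set (X α d)} (hU : IsClopen U) :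
    flux U h = 0 := by
  have hV := isClopen_preimage h hU
  have hopen := (isOpen_setOf_mapsTo hV.isClosed hU.isOpen).inter
    (isOpen_setOf_mapsTo hV.compl.isClosed hU.compl.isOpen)
  obtain ⟨f, ⟨hf1, hf2⟩, hf⟩ := mem_closure_iff.1 hh _ hopen ⟨fun x hx => hx, fun x hx => hx⟩
  have h1 : f ⁻¹' U = h ⁻¹' U := by
    ext x
    refine ⟨fun hx => ?_, fun hx => hf1 hx⟩
    by_contra hn
    exact hf2 hn hx
  rw [← flux_of_mem_F hf hU, flux, flux, h1]

end OrdinalHomeo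

/-! ### Approximation of homeomorphisms without flux by elements of `F` -/

/-- Homeomorphisms between pieces of two finite clopen partitions that agree outside the pieces glue
to a homeomorphism. -/
theorem exists_homeomorph_glue {Y Q : Type*} [TopologicalSpace Y] [CompactSpace Y] [T2Space Y]
    {p p' : Y → Q} {V V' : Q → Set Y} (hp : ∀ q, IsOpen (p ⁻¹' {q})) (hV : ∀ q, IsClopen (V q))
    (hVp : ∀ q, V q ⊆ p ⁻¹' {q}) (hVp' : ∀ q, V' q ⊆ p' ⁻¹' {q})
    (heq : ∀ q, p ⁻¹' {q} \ V q = p' ⁻¹' {q} \ V' q) (e : ∀ q, V q ≃ₜ V' q) :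
    ∃ f : Y ≃ₜ Y, (∀ x, p' (f x) = p x) ∧ ∀ x, x ∉ V (p x) → f x = x := by
  classical
  let f : Y → Y := fun x => if hx : x ∈ V (p x) then e (p x) ⟨x, hx⟩ else x
  have hf1 : ∀ q (x : V q), f x = e q x := by
    rintro q ⟨x, hx⟩
    obtain rfl : p x = q := hVp q hx
    exact dif_pos hx
  have hf2 : ∀ x, x ∉ V (p x) → f x = x := fun x hx => dif_neg hx
  -- Equality of the remainders is what lets the identity be used outside the pieces.
  have hout : ∀ x, x ∉ V (p x) → p' x = p x ∧ x ∉ V' (p x) := fun x hx => by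
    have h : x ∈ p ⁻¹' {p x} \ V (p x) := ⟨rfl, hx⟩
    rw [heq] at h
    exact h
  have hmem : ∀ x, x ∈ V (p x) → f x ∈ V' (p x) := fun x hx => by
    rw [hf1 (p x) ⟨x, hx⟩]
    exact (e (p x) ⟨x, hx⟩).2
  have hpf : ∀ x, p' (f x) = p x := by
    intro x
    by_cases hx : x ∈ V (p x)
    · exact hVp' _ (hmem x hx)
    · rw [hf2 x hx]
      exact (hout x hx).1
  have hcont : Continuous f := by
    rw [continuous_iff_continuousAt]
    intro x
    by_cases hx : x ∈ V (p x)
    · have h1 : ContinuousOn f (V (p x)) := by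
        rw [continuousOn_iff_continuous_domRestrict]
        have h2 : (V (p x)).domRestrict f = Subtype.val ∘ e (p x) := funext fun y => hf1 _ y
        rw [h2]
        exact continuous_subtype_val.comp (e (p x)).continuous
      exact h1.continuousAt ((hV _).isOpen.mem_nhds hx)
    · have h1 : p ⁻¹' {p x} \ V (p x) ∈ 𝓝 x :=
        ((hp _).sdiff (hV _).isClosed).mem_nhds ⟨rfl, hx⟩
      have h2 : f =ᶠ[𝓝 x] id := by
        filter_upwards [h1] with y hy
        obtain ⟨hy1, hy2⟩ := hy
        rw [mem_preimage, mem_singleton_iff] at hy1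
        rw [← hy1] at hy2
        exact hf2 y hy2
      exact continuousAt_id.congr h2.symm
  have hinj : Function.Injective f := by
    intro x y hxy
    have hpq : p x = p y := by rw [← hpf x, hxy, hpf y]
    by_cases hx : x ∈ V (p x) <;> by_cases hy : y ∈ V (p y)
    · have hy' : y ∈ V (p x) := hpq ▸ hy
      have h1 : e (p x) ⟨x, hx⟩ = e (p x) ⟨y, hy'⟩ := Subtype.ext (by
        rw [← hf1, ← hf1]
        exact hxy)
      exact congrArg Subtype.val ((e (p x)).injective h1)
    · refine absurd ?_ (hout y hy).2
      rw [hf2 y hy] at hxy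
      rw [← hpq, ← hxy]
      exact hmem x hx
    · refine absurd ?_ (hout x hx).2
      rw [hf2 x hx] at hxy
      rw [hpq, hxy]
      exact hmem y hy
    · rw [hf2 x hx, hf2 y hy] at hxy
      exact hxy
  have hsurj : Function.Surjective f := by
    intro y
    by_cases hy : y ∈ V' (p' y)
    · refine ⟨(e (p' y)).symm ⟨y, hy⟩, ?_⟩
      rw [hf1, Homeomorph.apply_symm_apply]
    · have h : y ∈ p' ⁻¹' {p' y} \ V' (p' y) := ⟨rfl, hy⟩
      rw [← heq] at h
      obtain ⟨h1, h2⟩ := h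
      rw [mem_preimage, mem_singleton_iff] at h1
      rw [← h1] at h2
      exact ⟨y, hf2 y h2⟩
  exact ⟨Continuous.homeoOfEquivCompactToT2 (f := Equiv.ofBijective f ⟨hinj, hsurj⟩) hcont,
    hpf, hf2⟩

namespace OrdinalHomeo

variable {α : Ordinal.{u}} {d : ℕ}

/-- Two clopen sets with the same points of maximal rank and balanced points of next-to-maximal rank
coincide outside homeomorphic clopen parts without points of maximal rank. -/
theorem exists_exchange {A A' : Set (X α d)} (hA : IsClopen A) (hA' : IsClopen A')
    (hM : ∀ x ∈ M α d, x ∈ A ↔ x ∈ A') {m : X α d} (hm : m ∈ M α d) (hmA : m ∈ A)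
    (hbal : relCard (N α d ∩ A) (N α d ∩ A') = 0) :
    ∃ V V' : Set (X α d), IsClopen V ∧ V ⊆ A ∧ V' ⊆ A' ∧ A \ V = A' \ V' ∧
      Disjoint V (M α d) ∧ Nonempty (V ≃ₜ V') := by
  have hmA' := (hM m hm).1 hmA
  -- The differences `A \ A'` and `A' \ A` may have no point of `N`, and then need not be
  -- homeomorphic. A clopen set `B` inside `A ∩ A'`, missing `M` and containing a point of `N`, is
  -- added to both.
  obtain ⟨z, ⟨hzA, hzN⟩, -⟩ := accPt_iff_nhds.1 (accPt_N hm) _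
    ((hA.isOpen.inter hA'.isOpen).mem_nhds ⟨hmA, hmA'⟩)
  have hO : IsOpen ((A ∩ A') \ M α d) :=
    (hA.isOpen.inter hA'.isOpen).sdiff finite_M.isClosed
  obtain ⟨B, hB, hzB, hBO⟩ :=
    compact_exists_isClopen_in_isOpen hO ⟨hzA, notMem_M_of_mem_N hzN⟩
  have hBM : Disjoint B (M α d) := Set.disjoint_left.2 fun x hx => (hBO hx).2
  have hd1 : Disjoint (A \ A') (M α d) :=
    Set.disjoint_left.2 fun x hx hxM => hx.2 ((hM x hxM).1 hx.1)
  have hd2 : Disjoint (A' \ A) (M α d) :=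
    Set.disjoint_left.2 fun x hx hxM => hx.2 ((hM x hxM).2 hx.1)
  have hVM : Disjoint (A \ A' ∪ B) (M α d) := hd1.union_left hBM
  have hVM' : Disjoint (A' \ A ∪ B) (M α d) := hd2.union_left hBM
  have hV : IsClopen (A \ A' ∪ B) := (hA.diff hA').union hB
  have hV' : IsClopen (A' \ A ∪ B) := (hA'.diff hA).union hB
  have hfB := finite_N_inter hB.isClosed hBM
  have hf1 := finite_N_inter (hA.diff hA').isClosed hd1
  have hf2 := finite_N_inter (hA'.diff hA).isClosed hd2
  have hc1 : (N α d ∩ (A \ A' ∪ B)).ncard = (N α d ∩ (A \ A')).ncard + (N α d ∩ B).ncard := by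
    rw [inter_union_distrib_left]
    refine ncard_union_eq ?_ hf1 hfB
    exact Set.disjoint_left.2 fun x hx hx' => hx.2.2 (hBO hx'.2).1.2
  have hc2 : (N α d ∩ (A' \ A ∪ B)).ncard = (N α d ∩ (A' \ A)).ncard + (N α d ∩ B).ncard := by
    rw [inter_union_distrib_left]
    refine ncard_union_eq ?_ hf2 hfB
    exact Set.disjoint_left.2 fun x hx hx' => hx.2.2 (hBO hx'.2).1.1
  have hB0 : (N α d ∩ B).ncard ≠ 0 := ncard_ne_zero_of_mem ⟨hzN, hzB⟩ hfB
  rw [relCard_eq (finite_symmDiff_N hA hA' hM), ← inter_sdiff_distrib_left,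
    ← inter_sdiff_distrib_left] at hbal
  have hcard : (N α d ∩ (A \ A' ∪ B)).ncard = (N α d ∩ (A' \ A ∪ B)).ncard := by omega
  refine ⟨A \ A' ∪ B, A' \ A ∪ B, hV, ?_, ?_, ?_, hVM,
    nonempty_homeomorph_of_isClopen hV hV' hVM hVM' (by omega) hcard⟩
  · exact union_subset sdiff_subset fun x hx => (hBO hx).1.1
  · exact union_subset sdiff_subset fun x hx => (hBO hx).1.2
  · ext x
    simp only [Set.mem_sdiff, mem_union]
    tauto

theorem mu_eq_of_mem_column {k i : ℕ} {hk : k ≤ d} {x : X α d} (hx : x ∈ M α d)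
    (h1 : x ∈ column α d i) (h2 : mu α d k hk ∈ column α d i) : x = mu α d k hk := by
  obtain ⟨l, hl, -, rfl⟩ := hx
  rw [mu_mem_column] at h1 h2
  subst h1 h2
  rfl

theorem flux_eq_zero_of_disjoint {U : Set (X α d)} (hU : IsClopen U) (hUM : Disjoint U (M α d))
    {h : H α d} (hh : h ∈ PH α d) : flux U h = 0 := by
  rw [flux_congr hU isClopen_empty
    (fun x hx => iff_of_false (Set.disjoint_right.1 hUM hx) (notMem_empty x)) hh]
  simp [flux, relCard_self]

/-- A homeomorphism without flux can be replaced, up to a finite clopen partition, by one that moves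
finitely many points of next-to-maximal rank. -/
theorem exists_mem_F_of_partition {Q : Type*} [Finite Q] {p : X α d → Q}
    (hp : ∀ q, IsClopen (p ⁻¹' {q})) (hinj : InjOn p (M α d)) {h : H α d} (hh : h ∈ PH α d)
    (hflux : ∀ i : Fin (d - 1), flux (column α d i) h⁻¹ = 0) :
    ∃ f ∈ F α d, ∀ x, p (h.symm (f x)) = p x := by
  have := Fintype.ofFinite Q
  have hh' : h⁻¹ ∈ PH α d := inv_mem hh
  have hp' : ∀ q, IsClopen ((p ∘ h.symm) ⁻¹' {q}) := fun q => (hp q).preimage h.symm.continuous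
  have hM : ∀ q, ∀ x ∈ M α d, x ∈ p ⁻¹' {q} ↔ x ∈ (p ∘ h.symm) ⁻¹' {q} := by
    intro q x hx
    have h1 : h.symm x = x := hh' x hx
    simp only [mem_preimage, Function.comp_apply, h1]
  have hrel : ∀ q, relCard (N α d ∩ p ⁻¹' {q}) (N α d ∩ (p ∘ h.symm) ⁻¹' {q}) =
      flux (p ⁻¹' {q}) h⁻¹ := fun q => rfl
  -- A class avoiding `μ_d` either misses `M` or meets it in one point, and then has the flux of the
  -- column of that point.
  have hzero : ∀ q, (∀ (x : X α d), x ∈ M α d → p x = q → (x : Ordinal.{u}) <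
      ω ^ (α + 1) * (d : Ordinal.{u})) → flux (p ⁻¹' {q}) h⁻¹ = 0 := by
    intro q hq
    by_cases hqM : Disjoint (p ⁻¹' {q}) (M α d)
    · exact flux_eq_zero_of_disjoint (hp q) hqM hh'
    · obtain ⟨x, hxq, hxM⟩ := Set.not_disjoint_iff.1 hqM
      have hlt := hq x hxM hxq
      obtain ⟨k, hk, h1, rfl⟩ := id hxM
      change ω ^ (α + 1) * (k : Ordinal.{u}) < _ at hlt
      rw [mul_lt_mul_iff_right₀ (omega0_opow_pos _), Nat.cast_lt] at hlt
      have hcol : mu α d k hk ∈ column α d (k - 1) := mu_mem_column.2 (by omega)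
      have h2 := hflux ⟨k - 1, by omega⟩
      rw [← h2]
      refine flux_congr (hp q) (isClopen_column _) (fun y hy => ⟨fun hyq => ?_, fun hyc => ?_⟩) hh'
      · rw [hinj hy hxM (Eq.trans hyq (Eq.symm hxq))]
        exact hcol
      · rw [mu_eq_of_mem_column hy hyc hcol]
        exact hxq
  have hall : ∀ q, flux (p ⁻¹' {q}) h⁻¹ = 0 := by
    intro q
    by_cases hq : ∀ (x : X α d), x ∈ M α d → p x = q → (x : Ordinal.{u}) <
      ω ^ (α + 1) * (d : Ordinal.{u})
    · exact hzero q hq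
    · push Not at hq
      obtain ⟨x, hxM, hxq, hx⟩ := hq
      -- The class of `μ_d` is handled by conservation: the fluxes of all classes add up to zero.
      have hsum := sum_relCard_fibers (N α d) p (p ∘ h.symm)
        fun q => finite_symmDiff_N (hp q) (hp' q) (hM q)
      simp only [hrel] at hsum
      rw [Finset.sum_eq_single q] at hsum
      · exact hsum
      · intro q' _ hne
        refine hzero q' fun y hy hyq => ?_
        refine lt_of_le_of_ne (Order.lt_add_one_iff.1 y.2) fun hyd => hne ?_
        have hxd := le_antisymm (Order.lt_add_one_iff.1 x.2) hx
        rw [← hyq, ← hxq, Subtype.ext (hyd.trans hxd.symm)]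
      · simp
  have hex : ∀ q, ∃ V V' : Set (X α d), IsClopen V ∧ V ⊆ p ⁻¹' {q} ∧
      V' ⊆ (p ∘ h.symm) ⁻¹' {q} ∧ p ⁻¹' {q} \ V = (p ∘ h.symm) ⁻¹' {q} \ V' ∧
      Disjoint V (M α d) ∧ Nonempty (V ≃ₜ V') := by
    intro q
    by_cases hqM : Disjoint (p ⁻¹' {q}) (M α d)
    -- On a class missing `M`, `h` itself is the required homeomorphism onto the image class; no
    -- count is needed.
    · refine ⟨p ⁻¹' {q}, (p ∘ h.symm) ⁻¹' {q}, hp q, Subset.rfl, Subset.rfl, by simp, hqM,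
        ⟨Homeomorph.sets h ?_⟩⟩
      ext x
      simp
    · obtain ⟨x, hxq, hxM⟩ := Set.not_disjoint_iff.1 hqM
      exact exists_exchange (hp q) (hp' q) (hM q) hxM hxq ((hrel q).trans (hall q))
  choose V V' hV hVp hVp' heq hVM e using hex
  obtain ⟨f, hf1, hf2⟩ := exists_homeomorph_glue (fun q => (hp q).isOpen) hV hVp hVp' heq
    fun q => (e q).some
  refine ⟨f, ?_, hf1⟩
  refine (Set.finite_iUnion fun q => finite_N_inter (hV q).isClosed (hVM q)).subset ?_
  rintro x ⟨hxN, hx⟩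
  refine mem_iUnion.2 ⟨p x, hxN, ?_⟩
  by_contra hn
  exact hx (hf2 x hn)

/-- For a subbasic set given by `K` and `U`, choose a clopen `C` with `h '' K ⊆ C ⊆ U`; preservation
of `h ⁻¹' C` by `h⁻¹ * g` forces `g` to map `K` into `U`. -/
theorem exists_finite_isClopen_of_isOpen {O : Set (H α d)} (hO : IsOpen O) {h : H α d}
    (hh : h ∈ O) : ∃ s : Set (Set (X α d)), s.Finite ∧ (∀ U ∈ s, IsClopen U) ∧
      ∀ g : H α d, (∀ U ∈ s, ∀ x ∈ U, h.symm (g x) ∈ U) → g ∈ O := by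
  have htop : compactOpenH α d = TopologicalSpace.generateFrom
      (preimage (fun h : H α d => (h : C(X α d, X α d))) ''
        (image2 (fun K U => {f : C(X α d, X α d) | MapsTo f K U}) {K | IsCompact K}
          {U | IsOpen U})) := induced_generateFrom_eq
  rw [htop] at hO
  induction hO with
  | basic O hO =>
    obtain ⟨_, ⟨K, hK, U, hU, rfl⟩, rfl⟩ := hO
    obtain ⟨C, hC, hKC, hCU⟩ := exists_clopen_of_closed_subset_open
      (hK.image h.continuous).isClosed hU (image_subset_iff.2 hh)
    refine ⟨{h ⁻¹' C}, finite_singleton _, ?_, ?_⟩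
    · rintro _ rfl
      exact isClopen_preimage h hC
    · intro g hg x hx
      have h1 := hg _ rfl x (hKC (mem_image_of_mem h hx))
      rw [mem_preimage, h.apply_symm_apply] at h1
      exact hCU h1
  | univ => exact ⟨∅, finite_empty, by simp, fun _ _ => trivial⟩
  | inter O₁ O₂ _ _ ih₁ ih₂ =>
    obtain ⟨s₁, hf₁, hc₁, hg₁⟩ := ih₁ hh.1
    obtain ⟨s₂, hf₂, hc₂, hg₂⟩ := ih₂ hh.2
    refine ⟨s₁ ∪ s₂, hf₁.union hf₂, ?_, ?_⟩
    · rintro U (hU | hU)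
      exacts [hc₁ U hU, hc₂ U hU]
    · intro g hg
      exact ⟨hg₁ g fun U hU => hg U (Or.inl hU), hg₂ g fun U hU => hg U (Or.inr hU)⟩
  | sUnion S _ ih =>
    obtain ⟨O, hOS, hO⟩ := hh
    obtain ⟨s, hf, hc, hg⟩ := ih O hOS hO
    exact ⟨s, hf, hc, fun g hg' => ⟨O, hOS, hg g hg'⟩⟩

theorem mem_Fbar_of_flux_eq_zero {h : H α d} (hh : h ∈ PH α d)
    (hflux : ∀ i : Fin (d - 1), flux (column α d i) h⁻¹ = 0) : h ∈ Fbar α d := by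
  refine mem_closure_iff.2 fun O hO hhO => ?_
  obtain ⟨s, hs, hsc, hsO⟩ := exists_finite_isClopen_of_isOpen hO hhO
  -- The columns are included so that the common partition separates the points of `M`.
  set t : Set (Set (X α d)) := s ∪ range fun i : Fin d => column α d i with ht
  have htf : t.Finite := hs.union (finite_range _)
  have := htf.to_subtype
  let p : X α d → Set t := fun x => {U | x ∈ (U : Set (X α d))}
  have htc : ∀ U ∈ t, IsClopen U := by
    rintro U (hU | ⟨i, rfl⟩)
    exacts [hsc U hU, isClopen_column _]
  have hpU : ∀ {x y : X α d}, p x = p y → ∀ U ∈ t, x ∈ U ↔ y ∈ U := fun hxy U hU =>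
    Set.ext_iff.1 hxy ⟨U, hU⟩
  have hp : ∀ q, IsClopen (p ⁻¹' {q}) := by
    intro q
    have h1 : p ⁻¹' {q} = ⋂ U : t, {x | x ∈ (U : Set (X α d)) ↔ U ∈ q} := by
      ext x
      rw [mem_iInter]
      exact Set.ext_iff
    rw [h1]
    refine isClopen_iInter_of_finite fun U => ?_
    by_cases hU : U ∈ q
    · simpa [hU] using htc U U.2
    · simp only [hU, iff_false]
      exact (htc U U.2).compl
  have hinj : InjOn p (M α d) := by
    rintro x hx y ⟨k, hk, h1, rfl⟩ hxy
    have hcol : mu α d k hk ∈ column α d (k - 1) := mu_mem_column.2 (by omega)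
    exact mu_eq_of_mem_column hx
      ((hpU hxy _ (Or.inr ⟨⟨k - 1, by omega⟩, rfl⟩)).2 hcol) hcol
  obtain ⟨f, hf, hpf⟩ := exists_mem_F_of_partition hp hinj hh hflux
  exact ⟨f, hsO f fun U hU x hx => (hpU (hpf x) U (Or.inl hU)).2 hx, hf⟩

theorem ker_fluxHom : (fluxHom α d).ker = (Fbar α d).subgroupOf (PH α d) := by
  ext h
  rw [MonoidHom.mem_ker, Subgroup.mem_subgroupOf]
  constructor
  · intro hker
    refine mem_Fbar_of_flux_eq_zero h.2 fun i => ?_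
    have h1 : fluxHom α d h⁻¹ = 1 := by rw [map_inv, hker, inv_one]
    change Multiplicative.toAdd (fluxHom α d h⁻¹) i = 0
    rw [h1]
    rfl
  · intro hF
    apply Multiplicative.toAdd.injective
    ext i
    rw [fluxHom_apply]
    exact flux_of_mem_Fbar hF (isClopen_column _)

end OrdinalHomeo

/-! ### Intervals of ordinals as finite or infinite unions of copies -/

namespace Ordinal

theorem mul_add_mem_Ioc_iff {a x : Ordinal.{u}} {k l : ℕ} (hx : x ∈ Ioc 0 a) :
    a * (k : Ordinal.{u}) + x ∈
      Ioc (a * (l : Ordinal.{u})) (a * ((l + 1 : ℕ) : Ordinal.{u})) ↔ k = l := by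
  have ha : 0 < a := hx.1.trans_le hx.2
  have h1 : a * (k : Ordinal.{u}) < a * k + x := lt_add_of_pos_right _ hx.1
  have h2 : a * (k : Ordinal.{u}) + x ≤ a * ((k + 1 : ℕ) : Ordinal.{u}) := by
    rw [Nat.cast_add_one, mul_add_one]
    exact add_le_add_right hx.2 _
  constructor
  · rintro ⟨h3, h4⟩
    have h5 := h1.trans_le h4
    have h6 := h3.trans_le h2
    rw [mul_lt_mul_iff_right₀ ha, Nat.cast_lt] at h5 h6
    omega
  · rintro rfl
    exact ⟨h1, h2⟩

theorem mul_add_inj {a x y : Ordinal.{u}} {k l : ℕ} (hx : x ∈ Ioc 0 a) (hy : y ∈ Ioc 0 a)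
    (h : a * (k : Ordinal.{u}) + x = a * (l : Ordinal.{u}) + y) : k = l ∧ x = y := by
  have h1 : k = l := by
    rw [← mul_add_mem_Ioc_iff hx, h]
    exact (mul_add_mem_Ioc_iff hy).2 rfl
  subst h1
  exact ⟨rfl, add_left_cancel h⟩

/-- Division with remainder in `(0, a]` rather than `[0, a)`, which makes the pieces compact and
open. -/
theorem exists_eq_mul_add {a y : Ordinal.{u}} {n : ℕ} (hy : y ∈ Ioc 0 (a * (n : Ordinal.{u}))) :
    ∃ k < n, ∃ x ∈ Ioc 0 a, y = a * (k : Ordinal.{u}) + x := by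
  induction n with
  | zero => simp at hy
  | succ n ih =>
    rcases le_or_gt y (a * n) with h | h
    · obtain ⟨k, hk, x, hx, hxy⟩ := ih ⟨hy.1, h⟩
      exact ⟨k, hk.trans (Nat.lt_succ_self n), x, hx, hxy⟩
    · have hs : a * (n : Ordinal.{u}) + (y - a * n) = y := Ordinal.add_sub_cancel_of_le h.le
      refine ⟨n, Nat.lt_succ_self n, y - a * n, ⟨?_, ?_⟩, hs.symm⟩
      · rw [pos_iff_ne_zero]
        intro h0
        rw [h0, add_zero] at hs
        exact h.ne hs
      · have h2 := hy.2
        rw [← hs, Nat.cast_add_one, mul_add_one] at h2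
        exact le_of_add_le_add_left h2

/-- The parametrization of `(0, a * n]` by `n` copies of `(0, a]`. -/
def copiesMap (a : Ordinal.{u}) (n : ℕ) (z : Fin n × Ioc 0 a) :
    Ioc 0 (a * (n : Ordinal.{u})) :=
  ⟨a * ((z.1 : ℕ) : Ordinal.{u}) + z.2, z.2.2.1.trans_le le_add_self, by
    refine (((mul_add_mem_Ioc_iff z.2.2).2 rfl).2).trans (mul_le_mul_right ?_ _)
    exact_mod_cast z.1.2⟩

theorem bijective_copiesMap (a : Ordinal.{u}) (n : ℕ) : Function.Bijective (copiesMap a n) := by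
  constructor
  · rintro ⟨k, x⟩ ⟨l, y⟩ h
    obtain ⟨h1, h2⟩ := mul_add_inj x.2 y.2 (congrArg Subtype.val h)
    exact Prod.ext (Fin.ext h1) (Subtype.ext h2)
  · rintro ⟨y, hy⟩
    obtain ⟨k, hk, x, hx, rfl⟩ := exists_eq_mul_add hy
    exact ⟨(⟨k, hk⟩, ⟨x, hx⟩), rfl⟩

theorem continuous_copiesMap (a : Ordinal.{u}) (n : ℕ) : Continuous (copiesMap a n) := by
  rw [continuous_prod_of_discrete_left]
  intro k
  exact ((continuous_add_left (a * ((k : ℕ) : Ordinal.{u}))).comp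
    continuous_subtype_val).subtype_mk _

/-- The interval `(0, a * n]` is homeomorphic to `n` copies of `(0, a]`. -/
def copiesHomeomorph (a : Ordinal.{u}) (n : ℕ) :
    Fin n × Ioc 0 a ≃ₜ Ioc 0 (a * (n : Ordinal.{u})) :=
  Continuous.homeoOfEquivCompactToT2 (f := Equiv.ofBijective _ (bijective_copiesMap a n))
    (continuous_copiesMap a n)

end Ordinal

/-- As `K` is compact, leaving all compact subsets of `ℕ × K` means that the first coordinate leaves
all finite sets. -/
theorem tendsto_fst_coclosedCompact (K : Type*) [TopologicalSpace K] [CompactSpace K] :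
    Tendsto (Prod.fst : ℕ × K → ℕ) (coclosedCompact (ℕ × K)) cofinite := by
  intro s hs
  rw [mem_cofinite] at hs
  rw [mem_map, hasBasis_coclosedCompact.mem_iff]
  refine ⟨sᶜ ×ˢ univ, ⟨(isClosed_discrete _).prod isClosed_univ,
    hs.isCompact.prod isCompact_univ⟩, ?_⟩
  rintro ⟨l, x⟩ h
  by_contra hn
  exact h ⟨hn, trivial⟩

theorem tendsto_coclosedCompact_of_fst {K ι : Type*} [TopologicalSpace K] [CompactSpace K]
    {f : ι → ℕ × K} {l : Filter ι} (h : Tendsto (fun i => (f i).1) l cofinite) :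
    Tendsto f l (coclosedCompact (ℕ × K)) := by
  intro s hs
  rw [hasBasis_coclosedCompact.mem_iff] at hs
  obtain ⟨C, ⟨-, hC⟩, hCs⟩ := hs
  have hfin : (Prod.fst '' C).Finite := (hC.image continuous_fst).finite_of_discrete
  have h1 : ∀ᶠ i in l, (f i).1 ∉ Prod.fst '' C := h hfin.compl_mem_cofinite
  rw [mem_map]
  filter_upwards [h1] with i hi
  exact hCs fun hC => hi (mem_image_of_mem _ hC)

namespace Ordinal

/-- The parametrization of `(0, b]`, `b = a * ω`, by a sequence of copies of `(0, a]` and the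
endpoint `b`. -/
def sequenceMap {a b : Ordinal.{u}} (ha : 0 < a) (hb : b = a * ω) (z : OnePoint (ℕ × Ioc 0 a)) :
    Ioc 0 b :=
  z.elim ⟨b, by rw [hb]; exact mul_pos ha omega0_pos, le_rfl⟩ fun y =>
    ⟨a * ((y.1 : ℕ) : Ordinal.{u}) + y.2, y.2.2.1.trans_le le_add_self, by
      rw [hb]
      exact (((mul_add_mem_Ioc_iff y.2.2).2 rfl).2).trans
        (mul_le_mul_right (natCast_lt_omega0 _).le _)⟩

variable {a b : Ordinal.{u}} (ha : 0 < a) (hb : b = a * ω)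

theorem sequenceMap_infty : (sequenceMap ha hb ∞ : Ordinal.{u}) = b := rfl

theorem mul_add_lt {a b : Ordinal.{u}} (ha : 0 < a) (hb : b = a * ω) (l : ℕ) (x : Ioc 0 a) :
    a * (l : Ordinal.{u}) + x < b := by
  refine (((mul_add_mem_Ioc_iff x.2).2 rfl).2).trans_lt ?_
  rw [hb]
  exact (mul_lt_mul_iff_right₀ ha).2 (natCast_lt_omega0 _)

theorem bijective_sequenceMap : Function.Bijective (sequenceMap ha hb) := by
  constructor
  · intro z w h
    have h' := congrArg Subtype.val h
    induction z using OnePoint.rec with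
    | infty =>
      induction w using OnePoint.rec with
      | infty => rfl
      | coe w => exact absurd h' (mul_add_lt ha hb w.1 w.2).ne'
    | coe z =>
      induction w using OnePoint.rec with
      | infty => exact absurd h' (mul_add_lt ha hb z.1 z.2).ne
      | coe w =>
        obtain ⟨h1, h2⟩ := mul_add_inj z.2.2 w.2.2 h'
        rw [Prod.ext h1 (Subtype.ext h2)]
  · rintro ⟨y, hy0, hy⟩
    rcases hy.eq_or_lt with rfl | hlt
    · exact ⟨∞, rfl⟩
    · rw [hb, lt_mul_iff_of_isSuccLimit isSuccLimit_omega0] at hlt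
      obtain ⟨c, hc, hyc⟩ := hlt
      obtain ⟨n, rfl⟩ := lt_omega0.1 hc
      obtain ⟨k, -, x, hx, rfl⟩ := exists_eq_mul_add ⟨hy0, hyc.le⟩
      exact ⟨((k, ⟨x, hx⟩) : ℕ × Ioc 0 a), rfl⟩

theorem continuous_sequenceMap : Continuous (sequenceMap ha hb) := by
  rw [OnePoint.continuous_iff]
  constructor
  · rw [tendsto_subtype_rng, tendsto_order]
    constructor
    · intro c hc
      rw [sequenceMap_infty, hb, lt_mul_iff_of_isSuccLimit isSuccLimit_omega0] at hc
      obtain ⟨m, hm, hcm⟩ := hc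
      obtain ⟨n, rfl⟩ := lt_omega0.1 hm
      have h1 : ∀ᶠ l : ℕ in cofinite, n ≤ l := by
        rw [Nat.cofinite_eq_atTop]
        exact eventually_ge_atTop n
      filter_upwards [(tendsto_fst_coclosedCompact (Ioc 0 a)).eventually h1] with z hz
      refine hcm.trans_le (le_trans ?_ le_self_add)
      exact mul_le_mul_right (by exact_mod_cast hz) _
    · intro c hc
      filter_upwards with z
      exact (mul_add_lt ha hb z.1 z.2).trans hc
  · rw [continuous_prod_of_discrete_left]
    intro l
    exact ((continuous_add_left (a * (l : Ordinal.{u}))).comp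
      continuous_subtype_val).subtype_mk _

/-- The interval `(0, a * ω]` is the one-point compactification of a sequence of copies of
`(0, a]`. -/
def sequenceHomeomorph : OnePoint (ℕ × Ioc 0 a) ≃ₜ Ioc 0 b :=
  Continuous.homeoOfEquivCompactToT2 (f := Equiv.ofBijective _ (bijective_sequenceMap ha hb))
    (continuous_sequenceMap ha hb)

end Ordinal

/-! ### The block model of `X` -/

namespace OrdinalHomeo

/-- The block `(0, ω ^ α]`. -/
abbrev Block (α : Ordinal.{u}) : Type (u + 1) := Ioc 0 (ω ^ α)

/-- The union of `d` one-point compactified sequences of blocks. -/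
abbrev Columns (α : Ordinal.{u}) (d : ℕ) : Type (u + 1) := Fin d × OnePoint (ℕ × Block α)

variable {α : Ordinal.{u}} {d : ℕ}

/-- The set `X` is an isolated point `0` together with the interval of positive points. -/
def zeroHomeomorph (α : Ordinal.{u}) (d : ℕ) :
    Unit ⊕ Ioc 0 (ω ^ (α + 1) * (d : Ordinal.{u})) ≃ₜ X α d := by
  refine Continuous.homeoOfEquivCompactToT2
    (f := Equiv.ofBijective (Sum.elim (fun _ => ⟨0, by simp⟩)
      fun x => ⟨x, Order.lt_add_one_iff.2 x.2.2⟩) ⟨?_, ?_⟩) ?_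
  · rintro (x | x) (y | y) h
    · rfl
    · exact absurd (congrArg Subtype.val h) y.2.1.ne
    · exact absurd (congrArg Subtype.val h) x.2.1.ne'
    · have h' := congrArg Subtype.val h
      exact congrArg Sum.inr (Subtype.ext h')
  · rintro ⟨y, hy⟩
    by_cases h0 : y = 0
    · subst h0
      exact ⟨Sum.inl (), rfl⟩
    · exact ⟨Sum.inr ⟨y, pos_iff_ne_zero.2 h0, Order.lt_add_one_iff.1 hy⟩, rfl⟩
  · exact Continuous.sumElim continuous_const (continuous_subtype_val.subtype_mk _)

/-- The homeomorphism between one column and `(0, ω ^ (α + 1)]`. -/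
def columnHomeomorph (α : Ordinal.{u}) : OnePoint (ℕ × Block α) ≃ₜ Ioc 0 (ω ^ (α + 1)) :=
  Ordinal.sequenceHomeomorph (omega0_opow_pos α) (Ordinal.opow_add_one ω α)

/-- The decomposition of `X` into the point `0` and `d` columns of blocks. -/
def model (α : Ordinal.{u}) (d : ℕ) : Unit ⊕ Columns α d ≃ₜ X α d :=
  (Homeomorph.sumCongr (Homeomorph.refl Unit)
    (((Homeomorph.refl (Fin d)).prodCongr (columnHomeomorph α)).trans
      (Ordinal.copiesHomeomorph (ω ^ (α + 1)) d))).trans (zeroHomeomorph α d)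

theorem model_inr (k : Fin d) (z : OnePoint (ℕ × Block α)) :
    (model α d (Sum.inr (k, z)) : Ordinal.{u}) =
      ω ^ (α + 1) * ((k : ℕ) : Ordinal.{u}) + (columnHomeomorph α z : Ordinal.{u}) := rfl

theorem model_infty (k : Fin d) : model α d (Sum.inr (k, ∞)) = mu α d (k + 1) k.2 := by
  apply Subtype.ext
  rw [model_inr]
  change _ + ω ^ (α + 1) = ω ^ (α + 1) * ((k + 1 : ℕ) : Ordinal.{u})
  rw [Nat.cast_add_one, mul_add_one]

theorem model_mem_column {k : Fin d} {z : OnePoint (ℕ × Block α)} {j : ℕ} :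
    model α d (Sum.inr (k, z)) ∈ column α d j ↔ (k : ℕ) = j := by
  rw [column, mem_preimage, model_inr]
  exact Ordinal.mul_add_mem_Ioc_iff (columnHomeomorph α z).2

/-- The two summands before `x` are multiples of `ω ^ α`, so the rank condition falls on `x ≤ ω ^ α`
alone: only the top of a block qualifies. -/
theorem model_coe_mem_N {k : Fin d} {l : ℕ} {x : Block α} :
    model α d (Sum.inr (k, ((l, x) : ℕ × Block α))) ∈ N α d ↔ (x : Ordinal.{u}) = ω ^ α := by
  have hval : (model α d (Sum.inr (k, ((l, x) : ℕ × Block α))) : Ordinal.{u}) =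
      ω ^ (α + 1) * ((k : ℕ) : Ordinal.{u}) + (ω ^ α * (l : Ordinal.{u}) + x) := rfl
  constructor
  · intro h
    rw [N_eq_cbLevel] at h
    have h1 := mem_cbLevel_iff.1 h.1
    have h0 : (model α d (Sum.inr (k, ((l, x) : ℕ × Block α))) : Ordinal.{u}) ≠ 0 := by
      rw [hval]
      exact (x.2.1.trans_le (le_add_self.trans le_add_self)).ne'
    rw [Ordinal.mem_cbLevel_iff h0, hval, Ordinal.dvd_add_iff, Ordinal.dvd_add_iff] at h1
    · exact le_antisymm x.2.2 (Ordinal.le_of_dvd x.2.1.ne' h1)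
    · exact dvd_mul_right _ _
    · rw [Ordinal.opow_add_one, mul_assoc]
      exact dvd_mul_right _ _
  · intro h
    refine Or.inl ⟨k, l + 1, k.2, by omega, ?_⟩
    rw [hval, h, Nat.cast_add_one, mul_add_one]

/-- Homeomorphisms of the union of columns act on `X`. -/
def modelHom (α : Ordinal.{u}) (d : ℕ) : (Columns α d ≃ₜ Columns α d) →* H α d where
  toFun g := (model α d).symm.trans
    ((Homeomorph.sumCongr (Homeomorph.refl Unit) g).trans (model α d))
  map_one' := by
    ext x
    change (model α d (Sum.map id id ((model α d).symm x)) : Ordinal.{u}) = x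
    simp
  map_mul' g h := by
    refine Homeomorph.ext fun x => ?_
    change model α d (Sum.map id (g * h : Columns α d ≃ₜ Columns α d) ((model α d).symm x)) =
      model α d (Sum.map id g ((model α d).symm
        (model α d (Sum.map id h ((model α d).symm x)))))
    rw [Homeomorph.symm_apply_apply, Sum.map_map]
    rfl

theorem modelHom_inr (g : Columns α d ≃ₜ Columns α d) (z : Columns α d) :
    modelHom α d g (model α d (Sum.inr z)) = model α d (Sum.inr (g z)) := by
  change model α d (Sum.map id g ((model α d).symm (model α d (Sum.inr z)))) = _
  rw [Homeomorph.symm_apply_apply]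
  rfl

theorem modelHom_inl (g : Columns α d ≃ₜ Columns α d) (z : Unit) :
    modelHom α d g (model α d (Sum.inl z)) = model α d (Sum.inl z) := by
  change model α d (Sum.map id g ((model α d).symm (model α d (Sum.inl z)))) = _
  rw [Homeomorph.symm_apply_apply]
  rfl

end OrdinalHomeo

/-! ### Translations of blocks and the section of the flux -/

namespace OrdinalHomeo

variable {α : Ordinal.{u}} {d : ℕ}

/-- The map of the columns that permutes the blocks by `σ` and fixes the endpoints. -/
def blockMap (α : Ordinal.{u}) (σ : Equiv.Perm (Fin d × ℕ)) (z : Columns α d) : Columns α d :=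
  z.2.elim (z.1, ∞) fun y =>
    ((σ (z.1, y.1)).1, (((σ (z.1, y.1)).2, y.2) : ℕ × Block α))

theorem blockMap_infty (σ : Equiv.Perm (Fin d × ℕ)) (k : Fin d) :
    blockMap α σ (k, ∞) = (k, ∞) := rfl

theorem blockMap_one (z : Columns α d) : blockMap α (1 : Equiv.Perm (Fin d × ℕ)) z = z := by
  obtain ⟨k, z⟩ := z
  induction z using OnePoint.rec with
  | infty => rfl
  | coe z => rfl

theorem blockMap_mul (σ τ : Equiv.Perm (Fin d × ℕ)) (z : Columns α d) :
    blockMap α (σ * τ) z = blockMap α σ (blockMap α τ z) := by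
  obtain ⟨k, z⟩ := z
  induction z using OnePoint.rec with
  | infty => rfl
  | coe z => rfl

/-- Near the end of a column all blocks stay in that column, and injectivity of `σ` makes their new
heights tend to infinity. -/
theorem continuous_blockMap {σ : Equiv.Perm (Fin d × ℕ)}
    (hσ : {j | (σ j).1 ≠ j.1}.Finite) : Continuous (blockMap α σ) := by
  rw [continuous_prod_of_discrete_left]
  intro k
  rw [OnePoint.continuous_iff]
  constructor
  · have h1 : ∀ᶠ l : ℕ in cofinite, (σ (k, l)).1 = k := by
      have hk : Function.Injective fun l : ℕ => (k, l) := Prod.mk_right_injective k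
      exact (hσ.preimage hk.injOn)
    have h2 : Tendsto (fun l : ℕ => (σ (k, l)).2) cofinite cofinite := by
      intro s hs
      have h3 : ∀ᶠ l : ℕ in cofinite, σ (k, l) ∉ ({k} : Set (Fin d)) ×ˢ sᶜ :=
        (σ.injective.comp (Prod.mk_right_injective k)).tendsto_cofinite.eventually
          ((finite_singleton k).prod hs).compl_mem_cofinite
      rw [mem_map]
      filter_upwards [h1, h3] with l hl1 hl3
      by_contra hn
      exact hl3 ⟨hl1, hn⟩
    rw [blockMap_infty, nhds_prod_eq]
    refine Tendsto.prodMk ?_ ?_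
    · refine tendsto_const_nhds.congr' ?_
      filter_upwards [(tendsto_fst_coclosedCompact (Block α)).eventually h1] with z hz
      exact hz.symm
    · refine OnePoint.tendsto_coe_infty.comp
        (tendsto_coclosedCompact_of_fst
          (f := fun z : ℕ × Block α => ((σ (k, z.1)).2, z.2)) ?_)
      exact h2.comp (tendsto_fst_coclosedCompact (Block α))
  · rw [continuous_prod_of_discrete_left]
    intro l
    exact (continuous_const (y := (σ (k, l)).1)).prodMk (OnePoint.continuous_coe.comp
      ((continuous_const (y := (σ (k, l)).2)).prodMk (continuous_id (X := Block α))))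

section shift

variable {n : ℕ}

/-- Bookkeeping of the blocks of `n + 1` columns as `n` two-sided sequences, the negative part of
the `i`-th one being the `i`-th column and the nonnegative parts together the last column. -/
theorem exists_twoSided_equiv (hn : n ≠ 0) : ∃ τ : Fin n × ℤ ≃ Fin (n + 1) × ℕ,
    ∀ j, (τ j).1 = if j.2 < 0 then j.1.castSucc else Fin.last n := by
  have : Nonempty (Fin n) := ⟨⟨0, Nat.pos_of_ne_zero hn⟩⟩
  have : Infinite (Fin n × ℕ) := Prod.infinite_of_right
  -- All nonnegative halves share the last column, so they are interleaved by a bijection; this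
  -- requires at least one sequence.
  obtain ⟨e⟩ := nonempty_equiv_of_countable (α := Fin n × ℕ) (β := ℕ)
  let f : Fin n × ℤ → Fin (n + 1) × ℕ := fun j =>
    match j with
    | (i, Int.ofNat m) => (Fin.last n, e (i, m))
    | (i, Int.negSucc m) => (i.castSucc, m)
  have hf : Function.Bijective f := by
    constructor
    · rintro ⟨i, m | m⟩ ⟨i', m' | m'⟩ h
      · have h1 : e (i, m) = e (i', m') := congrArg Prod.snd h
        have h2 := e.injective h1
        simp only [Prod.mk.injEq] at h2
        rw [h2.1, h2.2]
      · exact absurd (congrArg Prod.fst h) (Fin.castSucc_lt_last i').ne'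
      · exact absurd (congrArg Prod.fst h) (Fin.castSucc_lt_last i).ne
      · have h1 : i.castSucc = i'.castSucc := congrArg Prod.fst h
        have h2 : m = m' := congrArg Prod.snd h
        rw [Fin.castSucc_injective n h1, h2]
    · rintro ⟨k, l⟩
      induction k using Fin.lastCases with
      | last =>
        refine ⟨((e.symm l).1, Int.ofNat (e.symm l).2), ?_⟩
        change (Fin.last n, e (e.symm l)) = _
        rw [e.apply_symm_apply]
      | cast i => exact ⟨(i, Int.negSucc l), rfl⟩
  refine ⟨Equiv.ofBijective f hf, ?_⟩
  rintro ⟨i, m | m⟩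
  · have h : ¬ Int.ofNat m < 0 := by simp
    rw [if_neg h]
    rfl
  · rw [if_pos (Int.negSucc_lt_zero m)]
    rfl

/-- The translations of `n` copies of `ℤ`. -/
def translation (n : ℕ) : Multiplicative (Fin n → ℤ) →* Equiv.Perm (Fin n × ℤ) where
  toFun v := ⟨fun j => (j.1, j.2 + Multiplicative.toAdd v j.1),
    fun j => (j.1, j.2 - Multiplicative.toAdd v j.1), fun j => by simp, fun j => by simp⟩
  map_one' := by
    ext j
    · rfl
    · exact add_zero _
  map_mul' v w := by
    ext j
    · rfl
    · change j.2 + (Multiplicative.toAdd v j.1 + Multiplicative.toAdd w j.1) =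
        j.2 + Multiplicative.toAdd w j.1 + Multiplicative.toAdd v j.1
      ring

theorem translation_apply (v : Multiplicative (Fin n → ℤ)) (j : Fin n × ℤ) :
    translation n v j = (j.1, j.2 + Multiplicative.toAdd v j.1) := rfl

/-- The translations, as permutations of the blocks. -/
def blockShift (τ : Fin n × ℤ ≃ Fin (n + 1) × ℕ) :
    Multiplicative (Fin n → ℤ) →* Equiv.Perm (Fin (n + 1) × ℕ) :=
  τ.permCongrHom.toMonoidHom.comp (translation n)

theorem blockShift_apply (τ : Fin n × ℤ ≃ Fin (n + 1) × ℕ) (v : Multiplicative (Fin n → ℤ))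
    (j : Fin n × ℤ) :
    blockShift τ v (τ j) = τ (j.1, j.2 + Multiplicative.toAdd v j.1) := by
  change τ (translation n v (τ.symm (τ j))) = _
  rw [τ.symm_apply_apply, translation_apply]

variable {τ : Fin n × ℤ ≃ Fin (n + 1) × ℕ}

/-- A block changes column only if its integer coordinate changes sign, so that coordinate is
bounded by the length of the translation. -/
theorem finite_blockShift (hτ : ∀ j, (τ j).1 = if j.2 < 0 then j.1.castSucc else Fin.last n)
    (v : Multiplicative (Fin n → ℤ)) : {j | (blockShift τ v j).1 ≠ j.1}.Finite := by
  have hfin : (⋃ i : Fin n, ({i} : Set (Fin n)) ×ˢ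
      Icc (-|Multiplicative.toAdd v i|) |Multiplicative.toAdd v i|).Finite :=
    Set.finite_iUnion fun i => (finite_singleton i).prod (Set.finite_Icc _ _)
  refine (hfin.image τ).subset fun j hj => ?_
  obtain ⟨⟨i, m⟩, rfl⟩ := τ.surjective j
  refine mem_image_of_mem τ (mem_iUnion.2 ⟨i, rfl, ?_⟩)
  have hj' : (blockShift τ v (τ (i, m))).1 ≠ (τ (i, m)).1 := hj
  rw [blockShift_apply, hτ, hτ] at hj'
  dsimp only at hj'
  change -|Multiplicative.toAdd v i| ≤ m ∧ m ≤ |Multiplicative.toAdd v i|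
  have h1 := neg_abs_le (Multiplicative.toAdd v i)
  have h2 := le_abs_self (Multiplicative.toAdd v i)
  split_ifs at hj' with h3 h4 h4
  · exact absurd rfl hj'
  · constructor <;> omega
  · constructor <;> omega
  · exact absurd rfl hj'

/-- The action of `ℤ ^ n` on `n + 1` columns by translations of the blocks. -/
def columnShift (α : Ordinal.{u})
    (hτ : ∀ j, (τ j).1 = if j.2 < 0 then j.1.castSucc else Fin.last n) :
    Multiplicative (Fin n → ℤ) →* (Columns α (n + 1) ≃ₜ Columns α (n + 1)) where
  toFun v :=
    { toFun := blockMap α (blockShift τ v)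
      invFun := blockMap α (blockShift τ v⁻¹)
      left_inv := fun z => by
        rw [← blockMap_mul, ← map_mul, inv_mul_cancel, map_one, blockMap_one]
      right_inv := fun z => by
        rw [← blockMap_mul, ← map_mul, mul_inv_cancel, map_one, blockMap_one]
      continuous_toFun := continuous_blockMap (finite_blockShift hτ v)
      continuous_invFun := continuous_blockMap (finite_blockShift hτ v⁻¹) }
  map_one' := by
    refine Homeomorph.ext fun z => ?_
    change blockMap α (blockShift τ 1) z = z
    rw [map_one, blockMap_one]
  map_mul' v w := by
    refine Homeomorph.ext fun z => ?_
    change blockMap α (blockShift τ (v * w)) z =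
      blockMap α (blockShift τ v) (blockMap α (blockShift τ w) z)
    rw [map_mul, blockMap_mul]

variable (hτ : ∀ j, (τ j).1 = if j.2 < 0 then j.1.castSucc else Fin.last n)

theorem modelHom_columnShift_mem_PH (v : Multiplicative (Fin n → ℤ)) :
    modelHom α (n + 1) (columnShift α hτ v) ∈ PH α (n + 1) := by
  rintro x ⟨k, hk, h1, rfl⟩
  have h2 : mu α (n + 1) k hk = model α (n + 1) (Sum.inr (⟨k - 1, by omega⟩, ∞)) := by
    rw [model_infty]
    congr 1
    exact (Nat.sub_add_cancel h1).symm
  rw [h2, modelHom_inr]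
  rfl

/-- The action of `ℤ ^ n` on `X` by translations of the blocks. -/
def shiftHom (α : Ordinal.{u})
    (hτ : ∀ j, (τ j).1 = if j.2 < 0 then j.1.castSucc else Fin.last n) :
    Multiplicative (Fin n → ℤ) →* PH α (n + 1) :=
  ((modelHom α (n + 1)).comp (columnShift α hτ)).codRestrict (PH α (n + 1))
    (modelHom_columnShift_mem_PH hτ)

theorem coe_shiftHom (v : Multiplicative (Fin n → ℤ)) :
    (shiftHom α hτ v : H α (n + 1)) = modelHom α (n + 1) (columnShift α hτ v) := rfl

/-- The point of next-to-maximal rank in the block with a given index. -/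
def blockTop (α : Ordinal.{u}) (j : Fin d × ℕ) : X α d :=
  model α d (Sum.inr (j.1, ((j.2, ⟨ω ^ α, omega0_opow_pos α, le_rfl⟩) : ℕ × Block α)))

theorem blockTop_mem_N (j : Fin d × ℕ) : blockTop α j ∈ N α d := model_coe_mem_N.2 rfl

theorem blockTop_mem_column {j : Fin d × ℕ} {i : ℕ} :
    blockTop α j ∈ column α d i ↔ (j.1 : ℕ) = i := model_mem_column

theorem shiftHom_blockTop (v : Multiplicative (Fin n → ℤ)) (j : Fin (n + 1) × ℕ) :
    (shiftHom α hτ v : H α (n + 1)) (blockTop α j) = blockTop α (blockShift τ v j) := by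
  rw [coe_shiftHom, blockTop, modelHom_inr]
  rfl

/-- For `α = 0` the point `0` is in `N` without being a block top, but translations fix it. -/
theorem exists_eq_blockTop_of_ne {v : Multiplicative (Fin n → ℤ)} {x : X α (n + 1)}
    (hx : x ∈ N α (n + 1)) (hne : (shiftHom α hτ v : H α (n + 1)) x ≠ x) :
    ∃ j, x = blockTop α j := by
  obtain ⟨z | ⟨k, z⟩, rfl⟩ := (model α (n + 1)).surjective x
  · exact absurd (modelHom_inl _ _) hne
  · induction z using OnePoint.rec with
    | infty =>
      refine absurd ?_ hne
      rw [coe_shiftHom, modelHom_inr]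
      rfl
    | coe z =>
      obtain ⟨l, y⟩ := z
      have h := model_coe_mem_N.1 hx
      refine ⟨(k, l), ?_⟩
      rw [blockTop, Subtype.ext (a1 := y) (a2 := ⟨ω ^ α, omega0_opow_pos α, le_rfl⟩) h]

theorem toAdd_ofAdd_single (i j : Fin n) :
    Multiplicative.toAdd (Multiplicative.ofAdd (Pi.single i (1 : ℤ) : Fin n → ℤ)) j =
      if j = i then 1 else 0 := by
  rw [toAdd_ofAdd, Pi.single_apply]

/-- A unit translation of the `i`-th sequence moves exactly one block across a column boundary: the
one at `-1`, from column `i` to the last column. -/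
theorem flux_shiftHom_single (i j : Fin n) :
    flux (column α (n + 1) j)
      (shiftHom α hτ (Multiplicative.ofAdd (Pi.single i 1)) : H α (n + 1)) =
      (Pi.single i (1 : ℤ) : Fin n → ℤ) j := by
  set v : Multiplicative (Fin n → ℤ) := Multiplicative.ofAdd (Pi.single i 1) with hv
  have hsh : ∀ a : Fin n × ℤ, blockShift τ v (τ a) = τ (a.1, a.2 + if a.1 = i then 1 else 0) :=
    fun a => by rw [blockShift_apply, hv, toAdd_ofAdd_single]
  have hcol : ∀ a : Fin n × ℤ, blockTop α (τ a) ∈ column α (n + 1) j ↔ a.2 < 0 ∧ a.1 = j := by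
    intro a
    rw [blockTop_mem_column, hτ]
    split_ifs with h
    · rw [Fin.val_castSucc, ← Fin.ext_iff]
      simp [h]
    · have := j.2
      simp [h]
      omega
  have hmove : ∀ {x : X α (n + 1)}, x ∈ N α (n + 1) →
      ¬ ((shiftHom α hτ v : H α (n + 1)) x ∈ column α (n + 1) j ↔ x ∈ column α (n + 1) j) →
      ∃ a : Fin n × ℤ, x = blockTop α (τ a) := by
    intro x hx hn
    obtain ⟨b, rfl⟩ := exists_eq_blockTop_of_ne hτ hx (v := v) fun h => hn (by rw [h])
    exact ⟨τ.symm b, by rw [τ.apply_symm_apply]⟩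
  have hin : inSet α (n + 1) (column α (n + 1) j) (shiftHom α hτ v : H α (n + 1)) = ∅ := by
    rw [eq_empty_iff_forall_notMem]
    rintro x ⟨hxN, hx1, hx2⟩
    obtain ⟨a, rfl⟩ := hmove hxN fun h => hx1 (h.1 hx2)
    rw [shiftHom_blockTop, hsh, hcol] at hx2
    rw [hcol] at hx1
    dsimp only at hx2
    refine hx1 ⟨?_, hx2.2⟩
    have h1 := hx2.1
    split_ifs at h1 <;> omega
  have hout : outSet α (n + 1) (column α (n + 1) j) (shiftHom α hτ v : H α (n + 1)) =
      if j = i then {blockTop α (τ (i, -1))} else ∅ := by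
    ext x
    constructor
    · rintro ⟨hxN, hx1, hx2⟩
      obtain ⟨a, rfl⟩ := hmove hxN fun h => hx2 (h.2 hx1)
      rw [shiftHom_blockTop, hsh, hcol] at hx2
      rw [hcol] at hx1
      obtain ⟨h1, h2⟩ := hx1
      dsimp only at hx2
      subst h2
      have h3 : ¬ (a.2 + (if a.1 = i then 1 else 0) < 0) := fun h => hx2 ⟨h, rfl⟩
      split_ifs at h3 with h4
      · rw [if_pos h4]
        have h5 : a = (i, -1) := Prod.ext h4 (by dsimp only; omega)
        rw [h5]
        rfl
      · omega
    · split_ifs with hji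
      · rintro rfl
        refine ⟨blockTop_mem_N _, (hcol _).2 ⟨by simp, hji.symm⟩, ?_⟩
        rw [shiftHom_blockTop, hsh, hcol]
        simp
      · exact fun h => absurd h (notMem_empty x)
  have hfl := (hasFlux_flux (isClopen_column j) (shiftHom α hτ v).2).eq
  rw [hfl, hin, hout, Pi.single_apply]
  split_ifs <;> simp

theorem fluxHom_shiftHom (v : Multiplicative (Fin n → ℤ)) :
    fluxHom α (n + 1) (shiftHom α hτ v) = v := by
  let φ : (Fin n → ℤ) →+ (Fin n → ℤ) := AddMonoidHom.mk'
    (fun w => Multiplicative.toAdd (fluxHom α (n + 1) (shiftHom α hτ (Multiplicative.ofAdd w))))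
    fun w w' => by
      rw [ofAdd_add, map_mul, map_mul]
      rfl
  have h : φ = AddMonoidHom.id _ := by
    refine AddMonoidHom.functions_ext' _ _ _ fun i => AddMonoidHom.ext_int ?_
    ext j
    exact flux_shiftHom_single hτ i j
  exact congrArg Multiplicative.ofAdd (DFunLike.congr_fun h (Multiplicative.toAdd v))

end shift

end OrdinalHomeo

/-! ### The action on `M` and the two split extensions -/

namespace OrdinalHomeo

variable {α : Ordinal.{u}} {d : ℕ}

/-- The action of the homeomorphism group on the points of maximal rank. -/
def actionM (α : Ordinal.{u}) (d : ℕ) : H α d →* Equiv.Perm (M α d) where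
  toFun h := h.toEquiv.subtypeEquiv fun _ => (apply_mem_M h).symm
  map_one' := rfl
  map_mul' _ _ := rfl

theorem coe_actionM (h : H α d) (x : M α d) : (actionM α d h x : X α d) = h x := rfl

theorem ker_actionM : (actionM α d).ker = PH α d := by
  ext h
  rw [MonoidHom.mem_ker, Equiv.ext_iff]
  constructor
  · intro hh x hx
    exact congrArg Subtype.val (hh ⟨x, hx⟩)
  · intro hh x
    exact Subtype.ext (hh x x.2)

theorem bijective_mu : Function.Bijective fun k : Fin d =>
    (⟨mu α d (k + 1) k.2, k + 1, k.2, by omega, rfl⟩ : M α d) := by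
  constructor
  · intro k l h
    have h1 := congrArg (fun x : M α d => ((x : X α d) : Ordinal.{u})) h
    have h2 := mul_left_cancel₀ (omega0_opow_pos (α + 1)).ne' h1
    have h3 : (k : ℕ) + 1 = l + 1 := by exact_mod_cast h2
    exact Fin.ext (by omega)
  · rintro ⟨x, k, hk, h1, rfl⟩
    refine ⟨⟨k - 1, by omega⟩, Subtype.ext ?_⟩
    change mu α d (k - 1 + 1) (by omega) = _
    congr 1
    exact Nat.sub_add_cancel h1

/-- The points of maximal rank, indexed by the columns. -/
def muEquiv (α : Ordinal.{u}) (d : ℕ) : Fin d ≃ M α d := Equiv.ofBijective _ bijective_mu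

theorem coe_muEquiv (k : Fin d) : (muEquiv α d k : X α d) = model α d (Sum.inr (k, ∞)) :=
  (model_infty k).symm

/-- The permutations of the columns. -/
def columnPerm (α : Ordinal.{u}) (d : ℕ) :
    Equiv.Perm (Fin d) →* (Columns α d ≃ₜ Columns α d) where
  toFun σ :=
    { toFun := fun z => (σ z.1, z.2)
      invFun := fun z => (σ.symm z.1, z.2)
      left_inv := fun z => by simp
      right_inv := fun z => by simp
      continuous_toFun := (continuous_of_discreteTopology.comp continuous_fst).prodMk continuous_snd
      continuous_invFun :=
        (continuous_of_discreteTopology.comp continuous_fst).prodMk continuous_snd }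
  map_one' := rfl
  map_mul' _ _ := rfl

/-- The section of `actionM` that permutes the columns. -/
def permSection (α : Ordinal.{u}) (d : ℕ) : Equiv.Perm (M α d) →* H α d :=
  ((modelHom α d).comp (columnPerm α d)).comp (muEquiv α d).symm.permCongrHom.toMonoidHom

theorem actionM_permSection (σ : Equiv.Perm (M α d)) : actionM α d (permSection α d σ) = σ := by
  ext x
  obtain ⟨k, rfl⟩ := (muEquiv α d).surjective x
  rw [coe_actionM, coe_muEquiv]
  change (modelHom α d (columnPerm α d ((muEquiv α d).symm.permCongr σ))
    (model α d (Sum.inr (k, ∞))) : Ordinal.{u}) = _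
  rw [modelHom_inr]
  change (model α d (Sum.inr ((muEquiv α d).symm (σ (muEquiv α d k)), ∞)) : Ordinal.{u}) = _
  rw [← coe_muEquiv, Equiv.apply_symm_apply]

/-- The extension of the symmetric group by the pure homeomorphism group. -/
def permExtension (α : Ordinal.{u}) (d : ℕ) :
    GroupExtension (PH α d) (H α d) (Equiv.Perm (M α d)) where
  inl := (PH α d).subtype
  rightHom := actionM α d
  inl_injective := Subtype.val_injective
  range_inl_eq_ker_rightHom := by rw [Subgroup.range_subtype, ker_actionM]
  rightHom_surjective := fun σ => ⟨_, actionM_permSection σ⟩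

theorem exists_section_fluxHom (hd : 2 ≤ d) :
    ∃ s : Multiplicative (Fin (d - 1) → ℤ) →* PH α d, ∀ v, fluxHom α d (s v) = v := by
  obtain ⟨n, rfl⟩ : ∃ n, d = n + 1 := ⟨d - 1, by omega⟩
  obtain ⟨τ, hτ⟩ := exists_twoSided_equiv (n := n) (by omega)
  exact ⟨shiftHom α hτ, fluxHom_shiftHom hτ⟩

/-- The extension of `ℤ ^ (d - 1)` given by the flux homomorphism. -/
def fluxExtension (α : Ordinal.{u}) (d : ℕ) (hd : 2 ≤ d) :
    GroupExtension (Fbar α d) (PH α d) (Multiplicative (Fin (d - 1) → ℤ)) where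
  inl := Subgroup.inclusion Fbar_le_PH
  rightHom := fluxHom α d
  inl_injective := Subgroup.inclusion_injective _
  range_inl_eq_ker_rightHom := by rw [Subgroup.inclusion_range, ker_fluxHom]
  rightHom_surjective := fun v =>
    let ⟨s, hs⟩ := exists_section_fluxHom hd
    ⟨s v, hs v⟩

end OrdinalHomeo

end

theorem mainTheorem5 (α : Ordinal.{u}) (d : ℕ) (hd : 2 ≤ d) :
    (∃ S : GroupExtension (OrdinalHomeo.Fbar α d) (OrdinalHomeo.PH α d)
        (Multiplicative (Fin (d - 1) → ℤ)),
      (∀ f : OrdinalHomeo.Fbar α d, ((S.inl f : OrdinalHomeo.PH α d) : OrdinalHomeo.H α d) = f) ∧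
      (∀ Ω : Fin (d - 1) → Set (OrdinalHomeo.X α d), OrdinalHomeo.IsSeparating α d Ω →
        ∀ (h : OrdinalHomeo.PH α d) (i : Fin (d - 1)),
          OrdinalHomeo.HasFlux α d (Ω i) h (Multiplicative.toAdd (S.rightHom h) i)) ∧
      Nonempty S.Splitting) ∧
    (∃ S : GroupExtension (OrdinalHomeo.PH α d) (OrdinalHomeo.H α d)
        (Equiv.Perm (OrdinalHomeo.M α d)),
      S.inl = (OrdinalHomeo.PH α d).subtype ∧
      (∀ (h : OrdinalHomeo.H α d) (x : OrdinalHomeo.M α d),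
        ((S.rightHom h x : OrdinalHomeo.M α d) : OrdinalHomeo.X α d) = h x) ∧
      Nonempty S.Splitting) := by
  constructor
  · obtain ⟨s, hs⟩ := OrdinalHomeo.exists_section_fluxHom (α := α) hd
    exact ⟨OrdinalHomeo.fluxExtension α d hd, fun _ => rfl,
      fun Ω hΩ h i => OrdinalHomeo.hasFlux_fluxHom hΩ h i,
      ⟨{ toMonoidHom := s, rightInverse_rightHom := hs }⟩⟩
  · exact ⟨OrdinalHomeo.permExtension α d, rfl, fun _ _ => rfl,
      ⟨{ toMonoidHom := OrdinalHomeo.permSection α d,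
         rightInverse_rightHom := OrdinalHomeo.actionM_permSection }⟩⟩
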